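/- **Setting.** Fix $k\ge 1$ and, for $1\le i\le k$, a point process $Z_i=\sum_{j=1}^{N_i}\delta_{\xi^{(i)}_j}$ on $\mathbb R$ with $N_i=Z_i(\mathbb R)<\infty$ a.s. Put $\nu_i(a)=\log\mathbb E\big[\int_{\mathbb R}e^{ax}\,Z_i(dx)\big]$, and assume for every $i$: (A1) for some $\vartheta>0$, $\nu_i(a)$ is finite for all $a\in(-\vartheta,\infty)$; (A2) $\mathbb P(N_i=1)<1$, $\mathbb P(Z_i(\{a\})=N_i)<1$ for every $a\in\mathbb R$, and $\mathbb P(N_i\ge 1)=1$; (A3) $\mathbb E[N_i^{1+p}]<\infty$ for some $p>0$. Let $\theta_{(i)}=\inf\{a>0:\nu_i(a)/a=\nu_i'(a)\}\in[0,\infty]$, with $\inf\emptyset=\infty$. Let $q_i(n)\ge 0$ be integers with $\sum_{i=1}^k q_i(n)=n$, and let $t_m=\sum_{i\le m}q_i(n)$. For each $n$, consider the time inhomogeneous branching random walk started from one particle at the origin in which, for $t\in(t_{m-1},t_m]$, each particle of generation $t-1$ independently produces children whose displacements from it form a copy of the point process $Z_m$. Let $S(v)$ be the position of the particle $v$ and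 $|v|$ its generation. For $\theta>0$ put $$R_n^*(\theta)=\max_{|v|=n}\Big(S(v)-\tfrac1\theta\log E_v\Big),$$ where the $E_v$, $|v|=n$, are i.i.d. $\mathrm{Exponential}(1)$ and independent of the branching random walk. **Theorem.** Let $0<\theta<\theta_{(1)}$. Among the laws on $\mathbb R$ with mean $1$ there is exactly one solution of the linear recursive distributional equation $$\Delta\overset{d}{=}\sum_{j=1}^{N_1}e^{\theta\xi^{(1)}_j-\nu_1(\theta)}\,\Delta_j,$$ where $\Delta_1,\Delta_2,\dots$ are i.i.d. copies of $\Delta$, independent of $Z_1$. Let $D^\infty_{\theta,(1)}$ be a random variable with this law, which depends only on $\theta$ and the law of $Z_1$; it is a.s. positive. Let $E\sim\mathrm{Exponential}(1)$ be independent of $D^\infty_{\theta,(1)}$, and let $$H^\infty_{\theta,(1)}=\frac1\theta\big(\log D^\infty_{\theta,(1)}-\log E\big).$$ Then, whatever $k$ and $Z_2,\dots,Z_k$ satisfying the assumptions above with $\theta<\min_{1\le i\le k}\theta_{(i)}$, and whatever $q_1,\dots,q_k$ with $q_i(n)\to\infty$ for every $i$, $$R_n^*(\theta)-\sum_{i=1}^k\frac{q_i(n)\,\nu_i(\theta)}{\theta}\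 \xrightarrow{\ d\ }\ H^\infty_{\theta,(1)}.$$ -/

import Mathlib

open MeasureTheory ProbabilityTheory Filter
open scoped ENNReal Topology

namespace TIBRW

/-- The finite counting measure `δ_{x 0} + ⋯ + δ_{x (m - 1)}` on `ℝ`. -/
noncomputable def pointMeasure (m : ℕ) (x : ℕ → ℝ) : Measure ℝ :=
  ∑ j ∈ Finset.range m, Measure.dirac (x j)

theorem measurable_pointMeasure :
    Measurable (fun z : ℕ × (ℕ → ℝ) => pointMeasure z.1 z.2) := by
  refine measurable_from_prod_countable_right fun m => ?_
  refine Measure.measurable_of_measurable_coe _ fun s hs => ?_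
  simp only [pointMeasure, Measure.coe_finsetSum, Finset.sum_apply]
  refine Finset.measurable_sum _ fun j _ => ?_
  exact (Measure.measurable_coe hs).comp (Measure.measurable_dirac.comp (measurable_pi_apply j))

instance instIsProbabilityMeasureExpMeasureOne : IsProbabilityMeasure (expMeasure 1) :=
  isProbabilityMeasure_expMeasure one_pos

/-- A point process with a finite number of points is described by its law `ζ`, a probability
measure on the space of measures on `ℝ`. The probability measure `κ` is the law of an enumeration
`(N, (ξ_j)_j)` of a point process of law `ζ`: under `κ` the random measure `∑_{j < N} δ_{ξ_j}` has
law `ζ`. The values `ξ_j` with `j ≥ N` are irrelevant. -/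
structure IsEnumeration (κ : Measure (ℕ × (ℕ → ℝ))) (ζ : Measure (Measure ℝ)) : Prop where
  isProbabilityMeasure : IsProbabilityMeasure κ
  map_eq : κ.map (fun z => pointMeasure z.1 z.2) = ζ

/-- `ζ` is the law of a point process `Z = ∑_{j < N} δ_{ξ_j}` on `ℝ` with finitely many points. -/
def IsPointProcessLaw (ζ : Measure (Measure ℝ)) : Prop :=
  ∃ κ : Measure (ℕ × (ℕ → ℝ)), IsEnumeration κ ζ

/-- `𝔼[∫ e^{a x} Z(dx)]` for a point process `Z` of law `ζ`. -/
noncomputable def expMoment (ζ : Measure (Measure ℝ)) (a : ℝ) : ℝ≥0∞ :=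
  ∫⁻ z, ∫⁻ x, ENNReal.ofReal (Real.exp (a * x)) ∂z ∂ζ

/-- `ν(a) = log 𝔼[∫ e^{a x} Z(dx)]`. -/
noncomputable def nu (ζ : Measure (Measure ℝ)) (a : ℝ) : ℝ :=
  Real.log (expMoment ζ a).toReal

/-- The standing assumptions on the law `ζ` of a point process `Z` with `N = Z(ℝ)` points. -/
structure Assumptions (ζ : Measure (Measure ℝ)) : Prop where
  /-- `ν` is finite on `(-ϑ, ∞)` for some `ϑ > 0`. -/
  nu_finite : ∃ ϑ : ℝ, 0 < ϑ ∧ ∀ a : ℝ, -ϑ < a → 0 < expMoment ζ a ∧ expMoment ζ a < ∞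
  /-- `ℙ(N = 1) < 1`. -/
  card_nontrivial : ζ {z | z Set.univ = 1} < 1
  /-- `ℙ(Z({a}) = N) < 1` for all `a`. -/
  position_nontrivial : ∀ a : ℝ, ζ {z | z {a} = z Set.univ} < 1
  /-- `ℙ(N ≥ 1) = 1`. -/
  one_le_card : ζ {z | 1 ≤ z Set.univ} = 1
  /-- `𝔼[N^{1+p}] < ∞` for some `p > 0`. -/
  card_moment : ∃ p : ℝ, 0 < p ∧ ∫⁻ z, (z Set.univ) ^ (1 + p) ∂ζ < ∞

/-- `inf {a > 0 : ν(a) / a = ν'(a)}`, equal to `∞` if the set is empty. -/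
noncomputable def thetaCrit (ζ : Measure (Measure ℝ)) : EReal :=
  sInf ((fun a : ℝ => (a : EReal)) '' {a : ℝ | 0 < a ∧ nu ζ a / a = deriv (nu ζ) a})

/-- The probability measure `D` has mean `1` and solves the linear recursive distributional equation
`Δ =ᵈ ∑_{j < N} e^{θ ξ_j - ν(θ)} Δ_j`, where `∑_{j < N} δ_{ξ_j}` is a point process of law `ζ`,
`Δ, Δ_0, Δ_1, …` have law `D`, and `Δ_0, Δ_1, …` are i.i.d. and independent of `(N, (ξ_j)_j)`.
(The law of the right-hand side does not depend on the enumeration of the points.) -/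
structure IsMeanOneSolution (θ : ℝ) (ζ : Measure (Measure ℝ)) (D : ProbabilityMeasure ℝ) :
    Prop where
  integrable : Integrable (fun x : ℝ => x) (D : Measure ℝ)
  mean_eq_one : ∫ x, x ∂(D : Measure ℝ) = 1
  fixed_point : ∃ κ : Measure (ℕ × (ℕ → ℝ)), IsEnumeration κ ζ ∧
    (κ.prod (Measure.infinitePi (fun _ : ℕ => (D : Measure ℝ)))).map
      (fun w : (ℕ × (ℕ → ℝ)) × (ℕ → ℝ) =>
        ∑ j ∈ Finset.range w.1.1, Real.exp (θ * w.1.2 j - nu ζ θ) * w.2 j) = (D : Measure ℝ)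

/-! Particles are labelled by finite words of natural numbers, the most recent letter first: the
root is `[]`, and the children of the particle `v` are `j :: v` with `j < N v`. -/

/-- The particles of a given generation, where `N v` is the number of children of `v`. -/
def particles (N : List ℕ → ℕ) : ℕ → Finset (List ℕ)
  | 0 => {[]}
  | t + 1 => (particles N t).biUnion fun v => (Finset.range (N v)).image fun j => j :: v

/-- The position `S(v)`, where `ξ v j` is the displacement of the child `j :: v` from `v`. -/
def position (ξ : List ℕ → ℕ → ℝ) : List ℕ → ℝ
  | [] => 0
  | j :: v => position ξ v + ξ v j

/-- `R_n^*(θ) = max_{|v| = n} (S(v) + (1/θ) (-log E_v))`, a maximum over a finite set of particles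
(which is almost surely nonempty when every particle almost surely has a child). -/
noncomputable def rightmost (θ : ℝ) (n : ℕ) (N : List ℕ → ℕ) (ξ : List ℕ → ℕ → ℝ)
    (E : List ℕ → ℝ) : ℝ :=
  sSup ((fun v => position ξ v + 1 / θ * (-Real.log (E v))) ''
    (particles N n : Set (List ℕ)))

/-- The random variables `N v`, `ξ v j`, `E v` on the probability space `(Ω, P)` drive a last
progeny modified time inhomogeneous branching random walk up to generation `n = ∑ i, q i`: with
`t_i = ∑_{j ≤ i} q j`, the particles of generation `t - 1`, for `t_{i-1} < t ≤ t_i`, reproduce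
independently according to copies of the point process of law `ζ i`, and the `E v` with `|v| = n`
are independent standard exponential variables, independent of the branching random walk. -/
structure IsLPMTIBRW {k : ℕ} (ζ : Fin k → Measure (Measure ℝ)) (q : Fin k → ℕ)
    {Ω : Type*} [MeasurableSpace Ω] (P : Measure Ω)
    (N : List ℕ → Ω → ℕ) (ξ : List ℕ → ℕ → Ω → ℝ) (E : List ℕ → Ω → ℝ) : Prop where
  measurable_N : ∀ v, Measurable (N v)
  measurable_ξ : ∀ v j, Measurable (ξ v j)
  measurable_E : ∀ v, Measurable (E v)
  /-- The children of `v` are born at time `t = |v| + 1`. -/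
  law_offspring : ∀ (i : Fin k) (v : List ℕ),
    ∑ j ∈ Finset.Iio i, q j < v.length + 1 → v.length + 1 ≤ ∑ j ∈ Finset.Iic i, q j →
      HasLaw (fun ω => pointMeasure (N v ω) (fun j => ξ v j ω)) (ζ i) P
  indep_offspring : iIndepFun (fun (v : List ℕ) (ω : Ω) => (N v ω, fun j : ℕ => ξ v j ω)) P
  law_E : ∀ v : List ℕ, v.length = ∑ i, q i → HasLaw (E v) (expMeasure 1) P
  indep_E : iIndepFun E P
  indep_offspring_E :
    IndepFun (fun (ω : Ω) (v : List ℕ) => (N v ω, fun j : ℕ => ξ v j ω))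
      (fun (ω : Ω) (v : List ℕ) => E v ω) P

end TIBRW

namespace TIBRW

/-! ### Contraction properties of the smoothing transform -/

/-! Everything is read off from the smoothing transforms `branchOp`, `T_i f(t) = 𝔼 ∏_j f(t e^{θ ξ_j
- ν_i(θ)})`. Given the branching random walk, `-(1/θ) log E_v ≤ x - S(v)` has probability
`exp(-e^{-θ (x - S(v))})`, so `ℙ(R_n^* ≤ x) = 𝔼 ∏_{|v| = n} exp(-e^{-θ x} e^{θ S(v)})`. Integrating
out one generation at a time, from the last to the first, shows that the distribution function of
the centred maximum at `x` is `T_1^{q_1} ⋯ T_k^{q_k} (e^{-·})` at `e^{-θ x}`.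

Two estimates control this expression. The weights have mean total `1`, so a difference bounded by
`a t + b t^{1+δ}` becomes one bounded by `a t + b m t^{1+δ}` (`branchOp_sub_le`), with `m =
exp(ν((1+δ)θ) - (1+δ) ν(θ))`. Below the critical parameter `θ ν'(θ) < ν(θ)`, whence `m < 1` for
small `δ` (`IsEnumeration.eventually_isWeight`). Moreover, `e^{-t}` is moved by only `O(t^{1+δ})`,
so for `B` large the functions within `B t^{1+δ}` of `e^{-t}` form a set invariant under every `T_i`
(`norm_branchOp_sub_expFun_le`). The later phases therefore change `e^{-t}` only to second order,
uniformly in their lengths, and the many iterations of `T_1` erase that change.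

The limit is the Laplace transform of the mean-one fixed point `D` of the first transform, which at
`e^{-θ x}` is the distribution function of `(log D - log E)/θ`. The same contraction, applied to
characteristic functions, gives existence of `D` by iteration from `δ_1` (`exists_fixedPoint`) and
uniqueness among all real laws of mean `1` (`expTransform_I_eq_of_fixed`). -/

theorem measurable_of_measurable_slices {α β γ : Type*} [MeasurableSpace α] [MeasurableSpace γ]
    [MeasurableSpace β] [Countable β] [MeasurableSingletonClass β] {N : α → β} (hN : Measurable N)
    {F : β → α → γ} (hF : ∀ m, Measurable (F m)) : Measurable (fun a => F (N a) a) := by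
  have h : Measurable (fun p : β × α => F p.1 p.2) := measurable_from_prod_countable_right hF
  exact h.comp (hN.prodMk measurable_id)

/-- Exchange the factors one at a time; all the others have norm at most `1`. -/
theorem norm_prod_sub_prod_le {ι : Type*} (s : Finset ι) (f g : ι → ℂ)
    (hf : ∀ i ∈ s, ‖f i‖ ≤ 1) (hg : ∀ i ∈ s, ‖g i‖ ≤ 1) :
    ‖∏ i ∈ s, f i - ∏ i ∈ s, g i‖ ≤ ∑ i ∈ s, ‖f i - g i‖ := by
  classical
  induction s using Finset.induction_on with
  | empty => simp
  | insert a s ha ih =>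
    rw [Finset.prod_insert ha, Finset.prod_insert ha, Finset.sum_insert ha]
    have h1 : f a * ∏ i ∈ s, f i - g a * ∏ i ∈ s, g i
        = (f a - g a) * ∏ i ∈ s, f i + g a * (∏ i ∈ s, f i - ∏ i ∈ s, g i) := by ring
    have h2 : ‖∏ i ∈ s, f i‖ ≤ 1 := by
      rw [norm_prod]
      exact Finset.prod_le_one (fun _ _ => norm_nonneg _)
        fun i hi => hf i (Finset.mem_insert_of_mem hi)
    have h3 := ih (fun i hi => hf i (Finset.mem_insert_of_mem hi))
      (fun i hi => hg i (Finset.mem_insert_of_mem hi))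
    have h4 := hg a (Finset.mem_insert_self a s)
    rw [h1]
    refine (norm_add_le _ _).trans ?_
    rw [norm_mul, norm_mul]
    gcongr
    · exact mul_le_of_le_one_right (norm_nonneg _) h2
    · exact (mul_le_of_le_one_left (norm_nonneg _) h4).trans h3

/-- The total of the weights `A (ξ_j)`, `j < N`. -/
noncomputable def weightSum (A : ℝ → ℝ) (z : ℕ × (ℕ → ℝ)) : ℝ :=
  ∑ j ∈ Finset.range z.1, A (z.2 j)

theorem measurable_weightSum {A : ℝ → ℝ} (hA : Measurable A) : Measurable (weightSum A) :=
  measurable_of_measurable_slices (F := fun m (z : ℕ × (ℕ → ℝ)) => ∑ j ∈ Finset.range m, A (z.2 j))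
    measurable_fst fun m => Finset.measurable_sum (Finset.range m) fun j _ =>
      hA.comp ((measurable_pi_apply j).comp measurable_snd)

/-- `A (ξ_j)`, `j < N`, are positive weights with mean total `1`, whose powers of exponent `1 + δ`
have mean total at most `m`, and whose total has moment of order `1 + δ` at most `C`. -/
structure IsWeight (κ : Measure (ℕ × (ℕ → ℝ))) (A : ℝ → ℝ) (δ m C : ℝ) : Prop where
  isProbabilityMeasure : IsProbabilityMeasure κ
  measurable : Measurable A
  pos : ∀ x, 0 < A x
  integrable_weightSum : Integrable (weightSum A) κ
  mean_eq_one : ∫ z, weightSum A z ∂κ = 1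
  integrable_rpow : Integrable (weightSum fun x => A x ^ (1 + δ)) κ
  rpow_le : ∫ z, weightSum (fun x => A x ^ (1 + δ)) z ∂κ ≤ m
  integrable_weightSum_rpow : Integrable (fun z => weightSum A z ^ (1 + δ)) κ
  weightSum_rpow_le : ∫ z, weightSum A z ^ (1 + δ) ∂κ ≤ C

/-- The smoothing transform acting on functions: `f ↦ (t ↦ 𝔼 ∏_{j < N} f (t A(ξ_j)))`. -/
noncomputable def branchOp (κ : Measure (ℕ × (ℕ → ℝ))) (A : ℝ → ℝ) (f : ℝ → ℂ) (t : ℝ) : ℂ :=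
  ∫ z, ∏ j ∈ Finset.range z.1, f (t * A (z.2 j)) ∂κ

/-- Measurable functions bounded by `1` on the nonnegative half-line. -/
structure UnitBdd (f : ℝ → ℂ) : Prop where
  measurable : Measurable f
  norm_le : ∀ t, 0 ≤ t → ‖f t‖ ≤ 1

theorem measurable_branch_integrand {A : ℝ → ℝ} (hA : Measurable A) {f : ℝ → ℂ}
    (hf : Measurable f) :
    Measurable fun p : ℝ × (ℕ × (ℕ → ℝ)) => ∏ j ∈ Finset.range p.2.1, f (p.1 * A (p.2.2 j)) := by
  refine measurable_of_measurable_slices (N := fun p : ℝ × (ℕ × (ℕ → ℝ)) => p.2.1)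
    (F := fun m p => ∏ j ∈ Finset.range m, f (p.1 * A (p.2.2 j)))
    (measurable_fst.comp measurable_snd) fun m => Finset.measurable_prod _ fun j _ => ?_
  exact hf.comp (measurable_fst.mul
    (hA.comp ((measurable_pi_apply j).comp (measurable_snd.comp measurable_snd))))

theorem norm_branch_integrand_le {A : ℝ → ℝ} (hA : ∀ x, 0 < A x) {f : ℝ → ℂ} (hf : UnitBdd f)
    {t : ℝ} (ht : 0 ≤ t) (z : ℕ × (ℕ → ℝ)) :
    ‖∏ j ∈ Finset.range z.1, f (t * A (z.2 j))‖ ≤ 1 := by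
  rw [norm_prod]
  exact Finset.prod_le_one (fun _ _ => norm_nonneg _)
    fun j _ => hf.norm_le _ (mul_nonneg ht (hA _).le)

theorem integrable_branch_integrand {κ : Measure (ℕ × (ℕ → ℝ))} [IsProbabilityMeasure κ]
    {A : ℝ → ℝ} (hA : Measurable A) (hpos : ∀ x, 0 < A x) {f : ℝ → ℂ} (hf : UnitBdd f)
    {t : ℝ} (ht : 0 ≤ t) :
    Integrable (fun z : ℕ × (ℕ → ℝ) => ∏ j ∈ Finset.range z.1, f (t * A (z.2 j))) κ :=
  Integrable.of_bound
    ((measurable_branch_integrand hA hf.measurable).comp measurable_prodMk_left).aestronglyMeasurable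
    1 (ae_of_all _ fun z => norm_branch_integrand_le hpos hf ht z)

variable {κ : Measure (ℕ × (ℕ → ℝ))} {A : ℝ → ℝ} {δ m C : ℝ}

theorem UnitBdd.branchOp [IsProbabilityMeasure κ] (hA : Measurable A) (hpos : ∀ x, 0 < A x)
    {f : ℝ → ℂ} (hf : UnitBdd f) : UnitBdd (branchOp κ A f) where
  measurable := by
    have h := (measurable_branch_integrand hA hf.measurable).stronglyMeasurable
    exact (StronglyMeasurable.integral_prod_right
      (f := fun (t : ℝ) (z : ℕ × (ℕ → ℝ)) => ∏ j ∈ Finset.range z.1, f (t * A (z.2 j)))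
      (ν := κ) h).measurable
  norm_le t ht := by
    refine (norm_integral_le_integral_norm _).trans ?_
    refine (integral_mono (integrable_branch_integrand hA hpos hf ht).norm
      (integrable_const (1 : ℝ)) fun z => norm_branch_integrand_le hpos hf ht z).trans ?_
    simp

/-- The product difference is at most the sum of the differences at `t A(ξ_j)`. Taking means, the
linear coefficient is kept because the weights have mean total `1`, while the coefficient of `t ^ (1
+ δ)` is multiplied by the contraction factor `m`. -/
theorem branchOp_sub_le (hw : IsWeight κ A δ m C) {f g : ℝ → ℂ} (hf : UnitBdd f) (hg : UnitBdd g)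
    {a b : ℝ} (hb : 0 ≤ b)
    (hfg : ∀ t, 0 ≤ t → ‖f t - g t‖ ≤ a * t + b * t ^ (1 + δ)) {t : ℝ} (ht : 0 ≤ t) :
    ‖branchOp κ A f t - branchOp κ A g t‖ ≤ a * t + b * m * t ^ (1 + δ) := by
  have := hw.isProbabilityMeasure
  have hfi := integrable_branch_integrand (κ := κ) hw.measurable hw.pos hf ht
  have hgi := integrable_branch_integrand (κ := κ) hw.measurable hw.pos hg ht
  have h1 : branchOp κ A f t - branchOp κ A g t
      = ∫ z, (∏ j ∈ Finset.range z.1, f (t * A (z.2 j))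
        - ∏ j ∈ Finset.range z.1, g (t * A (z.2 j))) ∂κ := (integral_sub hfi hgi).symm
  rw [h1]
  have hint : Integrable (fun z => a * t * weightSum A z
      + b * t ^ (1 + δ) * weightSum (fun x => A x ^ (1 + δ)) z) κ :=
    (hw.integrable_weightSum.const_mul _).add (hw.integrable_rpow.const_mul _)
  calc _ ≤ ∫ z, ‖∏ j ∈ Finset.range z.1, f (t * A (z.2 j))
        - ∏ j ∈ Finset.range z.1, g (t * A (z.2 j))‖ ∂κ := norm_integral_le_integral_norm _
    _ ≤ ∫ z, (a * t * weightSum A z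
          + b * t ^ (1 + δ) * weightSum (fun x => A x ^ (1 + δ)) z) ∂κ := by
        refine integral_mono (hfi.sub hgi).norm hint fun z => ?_
        refine (norm_prod_sub_prod_le _ _ _
          (fun j _ => hf.norm_le _ (mul_nonneg ht (hw.pos _).le))
          (fun j _ => hg.norm_le _ (mul_nonneg ht (hw.pos _).le))).trans ?_
        simp only [weightSum]
        rw [Finset.mul_sum, Finset.mul_sum, ← Finset.sum_add_distrib]
        refine Finset.sum_le_sum fun j _ => ?_
        refine (hfg _ (mul_nonneg ht (hw.pos _).le)).trans_eq ?_
        rw [Real.mul_rpow ht (hw.pos _).le]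
        ring
    _ ≤ a * t + b * m * t ^ (1 + δ) := by
        rw [integral_add (hw.integrable_weightSum.const_mul _) (hw.integrable_rpow.const_mul _),
          integral_const_mul, integral_const_mul, hw.mean_eq_one]
        have := mul_le_mul_of_nonneg_left hw.rpow_le
          (mul_nonneg hb (Real.rpow_nonneg ht (1 + δ)))
        nlinarith [this]

theorem UnitBdd.iterate_branchOp [IsProbabilityMeasure κ] (hA : Measurable A)
    (hpos : ∀ x, 0 < A x) {f : ℝ → ℂ} (hf : UnitBdd f) (n : ℕ) :
    UnitBdd ((TIBRW.branchOp κ A)^[n] f) := by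
  induction n with
  | zero => exact hf
  | succ n ih => rw [Function.iterate_succ_apply']; exact ih.branchOp hA hpos

theorem iterate_branchOp_sub_le (hw : IsWeight κ A δ m C) (hm : 0 ≤ m) {f g : ℝ → ℂ}
    (hf : UnitBdd f) (hg : UnitBdd g) {a b : ℝ} (hb : 0 ≤ b)
    (hfg : ∀ t, 0 ≤ t → ‖f t - g t‖ ≤ a * t + b * t ^ (1 + δ)) (n : ℕ) {t : ℝ} (ht : 0 ≤ t) :
    ‖(branchOp κ A)^[n] f t - (branchOp κ A)^[n] g t‖ ≤ a * t + b * m ^ n * t ^ (1 + δ) := by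
  have := hw.isProbabilityMeasure
  induction n generalizing t with
  | zero => simpa using hfg t ht
  | succ n ih =>
    rw [Function.iterate_succ_apply', Function.iterate_succ_apply']
    refine (branchOp_sub_le hw (hf.iterate_branchOp hw.measurable hw.pos n)
      (hg.iterate_branchOp hw.measurable hw.pos n) (mul_nonneg hb (pow_nonneg hm n))
      (fun s hs => ih hs) ht).trans_eq ?_
    ring

/-- If `m < 1`, iterates of the smoothing transform forget their starting point. -/
theorem tendsto_iterate_branchOp_sub (hw : IsWeight κ A δ m C) (hm : 0 ≤ m) (hm1 : m < 1)
    {f : ℕ → ℝ → ℂ} {g : ℝ → ℂ} (hf : ∀ n, UnitBdd (f n)) (hg : UnitBdd g)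
    (hfg : ∀ ε > 0, ∃ b, 0 ≤ b ∧ ∀ n t, 0 ≤ t → ‖f n t - g t‖ ≤ ε * t + b * t ^ (1 + δ))
    {q : ℕ → ℕ} (hq : Tendsto q atTop atTop) {t : ℝ} (ht : 0 ≤ t) :
    Tendsto (fun n => (branchOp κ A)^[q n] (f n) t - (branchOp κ A)^[q n] g t) atTop (𝓝 0) := by
  rw [tendsto_zero_iff_norm_tendsto_zero, Metric.tendsto_atTop]
  intro ε hε
  -- The linear error does not contract, so its coefficient is chosen to cost at most `ε / 2` at
  -- this `t`; the `+ 1` covers `t = 0`.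
  obtain ⟨b, hb, hfg⟩ := hfg (ε / (2 * (t + 1))) (by positivity)
  have h1 : Tendsto (fun n => b * m ^ q n * t ^ (1 + δ)) atTop (𝓝 (b * 0 * t ^ (1 + δ))) :=
    (((tendsto_pow_atTop_nhds_zero_of_lt_one hm hm1).comp hq).const_mul b).mul_const _
  simp only [mul_zero, zero_mul] at h1
  obtain ⟨n₀, hn₀⟩ := (Metric.tendsto_atTop.1 h1) (ε / 2) (by positivity)
  refine ⟨n₀, fun n hn => ?_⟩
  have h2 := iterate_branchOp_sub_le hw hm (hf n) hg hb (fun t ht => hfg n t ht) (q n) ht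
  have h3 := hn₀ n hn
  rw [Real.dist_eq, sub_zero] at h3 ⊢
  rw [abs_of_nonneg (norm_nonneg _)]
  have h4 : ε / (2 * (t + 1)) * t ≤ ε / 2 := by
    rw [div_mul_eq_mul_div, div_le_div_iff₀ (by positivity) (by positivity)]
    nlinarith
  have h5 := le_abs_self (b * m ^ q n * t ^ (1 + δ))
  linarith

end TIBRW

namespace TIBRW

/-! ### Exponential transforms -/

/-- The error is quadratic near `0` and linear far away in the left half-plane. Keeping the minimum
allows dominated convergence under a first moment alone; `mul_min_one_le_rpow` turns it into a power
when a moment of order `1 + δ` is available. -/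
theorem norm_exp_sub_one_sub_le {z : ℂ} (hz : z.re ≤ 0) :
    ‖Complex.exp z - 1 - z‖ ≤ 3 * (‖z‖ * min 1 ‖z‖) := by
  rcases le_total ‖z‖ 1 with h | h
  · rw [min_eq_right h]
    refine (Complex.norm_exp_sub_one_sub_id_le h).trans ?_
    nlinarith [norm_nonneg z]
  · rw [min_eq_left h]
    have h1 : ‖Complex.exp z‖ ≤ 1 := by rw [Complex.norm_exp]; exact Real.exp_le_one_iff.2 hz
    have h2 : ‖Complex.exp z - 1 - z‖ ≤ ‖Complex.exp z‖ + ‖(1 : ℂ)‖ + ‖z‖ :=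
      (norm_sub_le _ _).trans (by gcongr; exact norm_sub_le _ _)
    rw [norm_one] at h2
    linarith

theorem mul_min_one_le_rpow {x δ : ℝ} (hx : 0 ≤ x) (hδ : 0 < δ) (hδ1 : δ ≤ 1) :
    x * min 1 x ≤ x ^ (1 + δ) := by
  rcases hx.eq_or_lt with rfl | hx
  · simp [Real.zero_rpow (by linarith : 1 + δ ≠ 0)]
  rw [Real.rpow_add hx, Real.rpow_one]
  gcongr
  rcases le_total x 1 with h | h
  · rw [min_eq_right h]
    simpa using Real.rpow_le_rpow_of_exponent_ge hx h hδ1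
  · rw [min_eq_left h]
    exact Real.one_le_rpow h hδ.le

theorem norm_exp_sub_one_sub_le_rpow {z : ℂ} (hz : z.re ≤ 0) {δ : ℝ} (hδ : 0 < δ) (hδ1 : δ ≤ 1) :
    ‖Complex.exp z - 1 - z‖ ≤ 3 * ‖z‖ ^ (1 + δ) :=
  (norm_exp_sub_one_sub_le hz).trans
    (by gcongr; exact mul_min_one_le_rpow (norm_nonneg z) hδ hδ1)

/-- The function `t ↦ e^{t u}`. -/
noncomputable def expFun (u : ℂ) (t : ℝ) : ℂ := Complex.exp (t * u)

/-- The transform `t ↦ ∫ e^{t x u} μ(dx)`: for `u = i` the characteristic function, for `u = -1` the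
Laplace transform. -/
noncomputable def expTransform (u : ℂ) (μ : Measure ℝ) (t : ℝ) : ℂ := ∫ x, expFun u (t * x) ∂μ

theorem norm_expFun_le {u : ℂ} {t : ℝ} (h : t * u.re ≤ 0) : ‖expFun u t‖ ≤ 1 := by
  rw [expFun, Complex.norm_exp]
  simpa using h

theorem continuous_expFun (u : ℂ) : Continuous (expFun u) := by
  unfold expFun; fun_prop

theorem continuous_expFun_mul (u : ℂ) (t : ℝ) : Continuous fun x => expFun u (t * x) :=
  (continuous_expFun u).comp (continuous_const.mul continuous_id)

theorem expFun_sum (u : ℂ) (t : ℝ) {ι : Type*} (s : Finset ι) (x : ι → ℝ) :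
    expFun u (t * ∑ j ∈ s, x j) = ∏ j ∈ s, expFun u (t * x j) := by
  simp only [expFun]
  rw [← Complex.exp_sum]
  congr 1
  push_cast
  rw [Finset.mul_sum, Finset.sum_mul]

theorem unitBdd_expFun {u : ℂ} (hu : u.re ≤ 0) : UnitBdd (expFun u) where
  measurable := (continuous_expFun u).measurable
  norm_le _ ht := norm_expFun_le (mul_nonpos_of_nonneg_of_nonpos ht hu)

theorem unitBdd_expTransform {u : ℂ} {μ : Measure ℝ} [IsProbabilityMeasure μ]
    (hμ : ∀ᵐ x ∂μ, x * u.re ≤ 0) : UnitBdd (expTransform u μ) where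
  measurable := by
    have h : StronglyMeasurable (Function.uncurry fun t x : ℝ => expFun u (t * x)) :=
      ((continuous_expFun u).comp continuous_mul).stronglyMeasurable
    exact (StronglyMeasurable.integral_prod_right (ν := μ) h).measurable
  norm_le t ht := by
    have h : ∀ᵐ x ∂μ, ‖expFun u (t * x)‖ ≤ 1 := by
      filter_upwards [hμ] with x hx
      refine norm_expFun_le ?_
      rw [mul_assoc]
      exact mul_nonpos_of_nonneg_of_nonpos ht hx
    simpa [expTransform] using norm_integral_le_of_norm_le_const h

theorem integrable_expFun_mul {u : ℂ} {μ : Measure ℝ} [IsProbabilityMeasure μ]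
    (hμ : ∀ᵐ x ∂μ, x * u.re ≤ 0) {t : ℝ} (ht : 0 ≤ t) :
    Integrable (fun x => expFun u (t * x)) μ := by
  refine Integrable.of_bound
    (continuous_expFun_mul u t).aestronglyMeasurable 1 ?_
  filter_upwards [hμ] with x hx
  refine norm_expFun_le ?_
  rw [mul_assoc]
  exact mul_nonpos_of_nonneg_of_nonpos ht hx

variable {κ : Measure (ℕ × (ℕ → ℝ))} {A : ℝ → ℝ} {δ m C : ℝ}

theorem weightSum_nonneg (hA : ∀ x, 0 < A x) (z : ℕ × (ℕ → ℝ)) : 0 ≤ weightSum A z :=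
  Finset.sum_nonneg fun _ _ => (hA _).le

theorem branchOp_expFun (u : ℂ) (t : ℝ) :
    branchOp κ A (expFun u) t = ∫ z, expFun u (t * weightSum A z) ∂κ := by
  simp only [branchOp, weightSum, expFun_sum]

/-- Both functions are compared with `1 + t u`, the common first-order expansion since the total
weight has mean `1`. The errors are `3 C t ^ (1 + δ)`, from the moment of the total weight, and `3 t
^ (1 + δ)`. -/
theorem norm_branchOp_expFun_sub_le (hw : IsWeight κ A δ m C) (hδ : 0 < δ) (hδ1 : δ ≤ 1) {u : ℂ}
    (hu : u.re ≤ 0) (hu1 : ‖u‖ = 1) {t : ℝ} (ht : 0 ≤ t) :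
    ‖branchOp κ A (expFun u) t - expFun u t‖ ≤ 3 * (C + 1) * t ^ (1 + δ) := by
  have := hw.isProbabilityMeasure
  have hre : ∀ s : ℝ, 0 ≤ s → ((s : ℂ) * u).re ≤ 0 := fun s hs => by
    simpa using mul_nonpos_of_nonneg_of_nonpos hs hu
  have hnorm : ∀ s : ℝ, 0 ≤ s → ‖(s : ℂ) * u‖ = s := fun s hs => by
    rw [norm_mul, hu1, mul_one, Complex.norm_real, Real.norm_of_nonneg hs]
  have h1 : Integrable (fun z => expFun u (t * weightSum A z)) κ := by
    refine Integrable.of_bound (C := 1) ?_ ?_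
    · exact ((continuous_expFun u).measurable.comp
        ((measurable_weightSum hw.measurable).const_mul t)).aestronglyMeasurable
    · refine ae_of_all _ fun z => norm_expFun_le ?_
      exact mul_nonpos_of_nonneg_of_nonpos (mul_nonneg ht (weightSum_nonneg hw.pos z)) hu
  have h0 : Integrable (fun z => ((t * weightSum A z : ℝ) : ℂ) * u) κ :=
    (hw.integrable_weightSum.const_mul t).ofReal.mul_const u
  have h2 : Integrable (fun z => 1 + ((t * weightSum A z : ℝ) : ℂ) * u) κ :=
    (integrable_const _).add h0
  have h3 : ∫ z, (1 + ((t * weightSum A z : ℝ) : ℂ) * u) ∂κ = 1 + t * u := by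
    rw [integral_add (integrable_const _) h0, integral_mul_const,
      integral_complex_ofReal, integral_const_mul, hw.mean_eq_one]
    simp
  have h4 : ‖branchOp κ A (expFun u) t - (1 + t * u)‖ ≤ 3 * C * t ^ (1 + δ) := by
    rw [branchOp_expFun, ← h3, ← integral_sub h1 h2]
    calc _ ≤ ∫ z, ‖expFun u (t * weightSum A z) - (1 + ((t * weightSum A z : ℝ) : ℂ) * u)‖ ∂κ :=
          norm_integral_le_integral_norm _
      _ ≤ ∫ z, 3 * t ^ (1 + δ) * weightSum A z ^ (1 + δ) ∂κ := by
          refine integral_mono (h1.sub h2).norm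
            (hw.integrable_weightSum_rpow.const_mul _) fun z => ?_
          have h0 := mul_nonneg ht (weightSum_nonneg hw.pos z)
          have h := norm_exp_sub_one_sub_le_rpow (hre _ h0) hδ hδ1
          rw [hnorm _ h0, Real.mul_rpow ht (weightSum_nonneg hw.pos z)] at h
          simp only [expFun]
          rw [← sub_sub]
          linarith
      _ ≤ 3 * C * t ^ (1 + δ) := by
          rw [integral_const_mul]
          have := mul_le_mul_of_nonneg_left hw.weightSum_rpow_le
            (Real.rpow_nonneg ht (1 + δ))
          linarith
  have h5 := norm_exp_sub_one_sub_le_rpow (hre t ht) hδ hδ1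
  rw [hnorm t ht, sub_sub] at h5
  have h6 : branchOp κ A (expFun u) t - expFun u t
      = (branchOp κ A (expFun u) t - (1 + t * u)) - (expFun u t - (1 + t * u)) := by ring
  rw [h6]
  refine (norm_sub_le _ _).trans ((add_le_add h4 h5).trans_eq ?_)
  ring

/-- Invariance of a ball around `e^{t u}`: the transform contracts the old error to `B m` and adds
at most `3 (C + 1)`, which the choice of `B` absorbs. The radius thus survives any number of
iterations. -/
theorem norm_branchOp_sub_expFun_le (hw : IsWeight κ A δ m C) (hδ : 0 < δ) (hδ1 : δ ≤ 1) {u : ℂ}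
    (hu : u.re ≤ 0) (hu1 : ‖u‖ = 1) {f : ℝ → ℂ} (hf : UnitBdd f) {B : ℝ} (hB : 0 ≤ B)
    (hBm : 3 * (C + 1) + B * m ≤ B)
    (hfB : ∀ t, 0 ≤ t → ‖f t - expFun u t‖ ≤ B * t ^ (1 + δ)) {t : ℝ} (ht : 0 ≤ t) :
    ‖branchOp κ A f t - expFun u t‖ ≤ B * t ^ (1 + δ) := by
  have h1 := branchOp_sub_le hw hf (unitBdd_expFun hu) (a := 0) hB
    (fun t ht => by simpa using hfB t ht) ht
  have h2 := norm_branchOp_expFun_sub_le hw hδ hδ1 hu hu1 ht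
  have h3 := mul_le_mul_of_nonneg_right hBm (Real.rpow_nonneg ht (1 + δ))
  have h4 : branchOp κ A f t - expFun u t = (branchOp κ A f t - branchOp κ A (expFun u) t)
      + (branchOp κ A (expFun u) t - expFun u t) := by ring
  rw [h4]
  refine (norm_add_le _ _).trans ?_
  linarith

theorem norm_iterate_branchOp_sub_expFun_le (hw : IsWeight κ A δ m C) (hδ : 0 < δ) (hδ1 : δ ≤ 1)
    {u : ℂ} (hu : u.re ≤ 0) (hu1 : ‖u‖ = 1) {f : ℝ → ℂ} (hf : UnitBdd f) {B : ℝ} (hB : 0 ≤ B)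
    (hBm : 3 * (C + 1) + B * m ≤ B)
    (hfB : ∀ t, 0 ≤ t → ‖f t - expFun u t‖ ≤ B * t ^ (1 + δ)) (n : ℕ) {t : ℝ} (ht : 0 ≤ t) :
    ‖(branchOp κ A)^[n] f t - expFun u t‖ ≤ B * t ^ (1 + δ) := by
  have := hw.isProbabilityMeasure
  induction n generalizing t with
  | zero => exact hfB t ht
  | succ n ih =>
    rw [Function.iterate_succ_apply']
    exact norm_branchOp_sub_expFun_le hw hδ hδ1 hu hu1
      (hf.iterate_branchOp hw.measurable hw.pos n) hB hBm (fun s hs => ih hs) ht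

/-- The transform of a law of mean `1` agrees with `e^{t u}` to first order at `0`. -/
theorem expTransform_near_expFun {μ : Measure ℝ} [IsProbabilityMeasure μ] (hδ : 0 < δ)
    {u : ℂ} (hu : u.re ≤ 0) (hu1 : ‖u‖ = 1) (hμ : ∀ᵐ x ∂μ, x * u.re ≤ 0)
    (hint : Integrable (fun x : ℝ => x) μ) (hmean : ∫ x, x ∂μ = 1) {ε : ℝ} (hε : 0 < ε) :
    ∃ b, 0 ≤ b ∧ ∀ t, 0 ≤ t → ‖expTransform u μ t - expFun u t‖ ≤ ε * t + b * t ^ (1 + δ) := by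
  have hnorm : ∀ s : ℝ, ‖(s : ℂ) * u‖ = |s| := fun s => by
    rw [norm_mul, hu1, mul_one, Complex.norm_real, Real.norm_eq_abs]
  have hmeas : ∀ t : ℝ, Measurable fun x : ℝ => |x| * min 1 (t * |x|) := fun t => by fun_prop
  have hI : ∀ t : ℝ, 0 ≤ t → Integrable (fun x : ℝ => |x| * min 1 (t * |x|)) μ := fun t ht => by
    refine hint.norm.mono' (hmeas t).aestronglyMeasurable (ae_of_all _ fun x => ?_)
    have : 0 ≤ min 1 (t * |x|) := le_min zero_le_one (by positivity)
    rw [Real.norm_of_nonneg (by positivity)]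
    exact mul_le_of_le_one_right (abs_nonneg x) (min_le_left _ _)
  -- Only a first moment is assumed, so the remainder has no rate; dominated convergence still gives
  -- `r t → 0`.
  set r : ℝ → ℝ := fun t => ∫ x, |x| * min 1 (t * |x|) ∂μ with hr
  have hr0 : Tendsto r (𝓝[≥] 0) (𝓝 0) := by
    have h : Tendsto r (𝓝[≥] 0) (𝓝 (∫ _x : ℝ, (0 : ℝ) ∂μ)) := by
      refine tendsto_integral_filter_of_dominated_convergence (fun x => |x|)
        (Eventually.of_forall fun t => (hmeas t).aestronglyMeasurable) ?_ hint.norm ?_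
      · filter_upwards [self_mem_nhdsWithin] with t ht
        refine ae_of_all _ fun x => ?_
        have : 0 ≤ min 1 (t * |x|) := le_min zero_le_one (mul_nonneg ht (abs_nonneg x))
        rw [Real.norm_of_nonneg (by positivity)]
        exact mul_le_of_le_one_right (abs_nonneg x) (min_le_left _ _)
      · refine ae_of_all _ fun x => Tendsto.mono_left ?_ nhdsWithin_le_nhds
        have : Continuous fun t : ℝ => |x| * min 1 (t * |x|) := by fun_prop
        simpa using this.tendsto 0
    simpa using h
  have hbound : ∀ t, 0 ≤ t →
      ‖expTransform u μ t - expFun u t‖ ≤ t * (3 * r t + 3 * min 1 t) := fun t ht => by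
    have h0 : Integrable (fun x : ℝ => ((t * x : ℝ) : ℂ) * u) μ :=
      (hint.const_mul t).ofReal.mul_const u
    have h2 : Integrable (fun x : ℝ => 1 + ((t * x : ℝ) : ℂ) * u) μ := (integrable_const _).add h0
    have h3 : ∫ x : ℝ, (1 + ((t * x : ℝ) : ℂ) * u) ∂μ = 1 + t * u := by
      rw [integral_add (integrable_const _) h0, integral_mul_const, integral_complex_ofReal, integral_const_mul, hmean]
      simp
    have h1 := integrable_expFun_mul (u := u) hμ ht
    have h4 : ‖expTransform u μ t - (1 + t * u)‖ ≤ 3 * t * r t := by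
      rw [expTransform, ← h3, ← integral_sub h1 h2]
      calc _ ≤ ∫ x, ‖expFun u (t * x) - (1 + ((t * x : ℝ) : ℂ) * u)‖ ∂μ :=
            norm_integral_le_integral_norm _
        _ ≤ ∫ x, 3 * t * (|x| * min 1 (t * |x|)) ∂μ := by
            refine integral_mono_ae (h1.sub h2).norm ((hI t ht).const_mul _) ?_
            filter_upwards [hμ] with x hx
            have hre : (((t * x : ℝ) : ℂ) * u).re ≤ 0 := by
              rw [Complex.re_ofReal_mul, mul_assoc]
              exact mul_nonpos_of_nonneg_of_nonpos ht hx
            have h := norm_exp_sub_one_sub_le hre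
            rw [hnorm, abs_mul, abs_of_nonneg ht] at h
            simp only [expFun]
            rw [← sub_sub]
            linarith
        _ = _ := by rw [integral_const_mul]
    have hre : ((t : ℂ) * u).re ≤ 0 := by
      rw [Complex.re_ofReal_mul]
      exact mul_nonpos_of_nonneg_of_nonpos ht hu
    have h5 := norm_exp_sub_one_sub_le hre
    rw [hnorm, abs_of_nonneg ht, sub_sub] at h5
    have h6 : expTransform u μ t - expFun u t
        = (expTransform u μ t - (1 + t * u)) - (expFun u t - (1 + t * u)) := by ring
    rw [h6]
    refine (norm_sub_le _ _).trans ((add_le_add h4 h5).trans_eq ?_)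
    ring
  have hlim : Tendsto (fun t => 3 * r t + 3 * min 1 t) (𝓝[≥] 0) (𝓝 0) := by
    have h : Tendsto (fun t : ℝ => 3 * min 1 t) (𝓝[≥] 0) (𝓝 0) := by
      have : Continuous fun t : ℝ => 3 * min 1 t := by fun_prop
      simpa using (this.tendsto 0).mono_left nhdsWithin_le_nhds
    simpa using (hr0.const_mul 3).add h
  obtain ⟨t₀, ht₀, hsmall⟩ := mem_nhdsGE_iff_exists_Ico_subset.1 (hlim (Iio_mem_nhds hε))
  have ht₀ : 0 < t₀ := ht₀
  have hc : ∀ t, 0 ≤ t → 3 * r t + 3 * min 1 t ≤ 3 * (∫ x, |x| ∂μ) + 3 := fun t ht => by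
    have h1 : r t ≤ ∫ x, |x| ∂μ := integral_mono (hI t ht) hint.norm fun x =>
      mul_le_of_le_one_right (abs_nonneg x) (min_le_left _ _)
    have h2 := min_le_left 1 t
    linarith
  have hK : 0 ≤ ∫ x, |x| ∂μ := integral_nonneg fun x => abs_nonneg x
  -- Below `t₀` the remainder costs at most `ε t`. Beyond `t₀` it is at most a constant times `t`,
  -- and `1 ≤ t ^ δ / t₀ ^ δ` turns this into a multiple of `t ^ (1 + δ)`.
  refine ⟨(3 * (∫ x, |x| ∂μ) + 3) / t₀ ^ δ, by positivity, fun t ht => ?_⟩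
  refine (hbound t ht).trans ?_
  rcases lt_or_ge t t₀ with h | h
  · have h1 : 3 * r t + 3 * min 1 t < ε := hsmall ⟨ht, h⟩
    have h2 : 0 ≤ (3 * (∫ x, |x| ∂μ) + 3) / t₀ ^ δ * t ^ (1 + δ) := by positivity
    have h3 := mul_le_mul_of_nonneg_left h1.le ht
    linarith
  · have htpos := ht₀.trans_le h
    have h1 : 1 ≤ t ^ δ / t₀ ^ δ := by
      rw [one_le_div (by positivity)]
      exact Real.rpow_le_rpow ht₀.le h hδ.le
    have h2 : (3 * (∫ x, |x| ∂μ) + 3) / t₀ ^ δ * t ^ (1 + δ)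
        = t * (3 * (∫ x, |x| ∂μ) + 3) * (t ^ δ / t₀ ^ δ) := by
      rw [Real.rpow_add htpos, Real.rpow_one]; ring
    rw [h2]
    have h3 := mul_le_mul_of_nonneg_left (hc t ht) ht
    have h4 : t * (3 * (∫ x, |x| ∂μ) + 3) ≤ t * (3 * (∫ x, |x| ∂μ) + 3) * (t ^ δ / t₀ ^ δ) :=
      le_mul_of_one_le_right (by positivity) h1
    have h5 : 0 ≤ ε * t := by positivity
    linarith

/-! ### The smoothing transform on laws -/

/-- The law of `∑_{j < N} A(ξ_j) Δ_j`, where the `Δ_j` are i.i.d. of law `μ`, independent of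
`(N, (ξ_j)_j)`. -/
noncomputable def smoothing (κ : Measure (ℕ × (ℕ → ℝ))) (A : ℝ → ℝ) (μ : Measure ℝ) : Measure ℝ :=
  (κ.prod (Measure.infinitePi fun _ : ℕ => μ)).map
    fun w => ∑ j ∈ Finset.range w.1.1, A (w.1.2 j) * w.2 j

theorem measurable_smoothing_sum (hA : Measurable A) :
    Measurable fun w : (ℕ × (ℕ → ℝ)) × (ℕ → ℝ) =>
      ∑ j ∈ Finset.range w.1.1, A (w.1.2 j) * w.2 j :=
  measurable_of_measurable_slices (N := fun w : (ℕ × (ℕ → ℝ)) × (ℕ → ℝ) => w.1.1)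
    (F := fun m w => ∑ j ∈ Finset.range m, A (w.1.2 j) * w.2 j)
    (measurable_fst.comp measurable_fst) fun _ => Finset.measurable_sum _ fun j _ =>
      (hA.comp ((measurable_pi_apply j).comp (measurable_snd.comp measurable_fst))).mul
        ((measurable_pi_apply j).comp measurable_snd)

theorem isProbabilityMeasure_smoothing [IsProbabilityMeasure κ] (hA : Measurable A)
    (μ : Measure ℝ) [IsProbabilityMeasure μ] : IsProbabilityMeasure (smoothing κ A μ) :=
  Measure.isProbabilityMeasure_map (measurable_smoothing_sum hA).aemeasurable

theorem ae_infinitePi_of_ae {μ : Measure ℝ} [IsProbabilityMeasure μ] {p : ℝ → Prop}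
    (h : ∀ᵐ x ∂μ, p x) : ∀ᵐ y ∂(Measure.infinitePi fun _ : ℕ => μ), ∀ j, p (y j) := by
  rw [ae_all_iff]
  intro j
  exact (measurePreserving_eval_infinitePi (fun _ : ℕ => μ) j).quasiMeasurePreserving.ae h

theorem ae_prod_infinitePi_of_ae [IsProbabilityMeasure κ] {μ : Measure ℝ} [IsProbabilityMeasure μ]
    {p : ℝ → Prop} (h : ∀ᵐ x ∂μ, p x) :
    ∀ᵐ w ∂κ.prod (Measure.infinitePi fun _ : ℕ => μ), ∀ j, p (w.2 j) :=
  Measure.quasiMeasurePreserving_snd.ae (ae_infinitePi_of_ae h)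

theorem ae_smoothing_nonneg [IsProbabilityMeasure κ] (hA : Measurable A) (hpos : ∀ x, 0 < A x)
    {μ : Measure ℝ} [IsProbabilityMeasure μ] (hμ : ∀ᵐ x ∂μ, 0 ≤ x) :
    ∀ᵐ x ∂(smoothing κ A μ), 0 ≤ x := by
  rw [smoothing, ae_map_iff (measurable_smoothing_sum hA).aemeasurable measurableSet_Ici]
  filter_upwards [ae_prod_infinitePi_of_ae hμ] with w hw
  exact Finset.sum_nonneg fun j _ => mul_nonneg (hpos _).le (hw j)

theorem integral_infinitePi_prod_range {μ : Measure ℝ} [IsProbabilityMeasure μ] (n : ℕ)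
    {g : ℕ → ℝ → ℂ} (hg : ∀ j, Measurable (g j)) :
    ∫ y, ∏ j ∈ Finset.range n, g j (y j) ∂(Measure.infinitePi fun _ : ℕ => μ)
      = ∏ j ∈ Finset.range n, ∫ x, g j x ∂μ := by
  have hind : iIndepFun (fun (j : ℕ) (y : ℕ → ℝ) => y j) (Measure.infinitePi fun _ : ℕ => μ) :=
    iIndepFun_infinitePi (X := fun _ x => x) fun _ => measurable_id
  have hind' : iIndepFun (fun (j : Fin n) (y : ℕ → ℝ) => y j)
      (Measure.infinitePi fun _ : ℕ => μ) := hind.precomp Fin.val_injective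
  have h := hind'.integral_fun_prod_comp (f := fun j : Fin n => g j) (fun j => (measurable_pi_apply _).aemeasurable)
    fun j => (hg j).aestronglyMeasurable
  simp only [Finset.prod_range]
  rw [h]
  refine Finset.prod_congr rfl fun j _ => ?_
  have hmp := measurePreserving_eval_infinitePi (fun _ : ℕ => μ) (j : ℕ)
  rw [← integral_map (φ := fun y : ℕ → ℝ => y j) (measurable_pi_apply _).aemeasurable
    (hg j).aestronglyMeasurable]
  congr 1
  exact hmp.map_eq

/-- Given the weights, the `Δ_j` are independent, so the transform of the sum factorizes. The sign
conditions on `x * u.re` and `t` keep the integrand bounded by `1`, which justifies Fubini. -/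
theorem expTransform_smoothing [IsProbabilityMeasure κ] (hA : Measurable A) (hpos : ∀ x, 0 < A x)
    {u : ℂ} {μ : Measure ℝ} [IsProbabilityMeasure μ] (hμ : ∀ᵐ x ∂μ, x * u.re ≤ 0) {t : ℝ}
    (ht : 0 ≤ t) :
    expTransform u (smoothing κ A μ) t = branchOp κ A (expTransform u μ) t := by
  have hmeas : Measurable fun w : (ℕ × (ℕ → ℝ)) × (ℕ → ℝ) =>
      expFun u (t * ∑ j ∈ Finset.range w.1.1, A (w.1.2 j) * w.2 j) :=
    (continuous_expFun u).measurable.comp ((measurable_smoothing_sum hA).const_mul t)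
  have hint : Integrable (fun w : (ℕ × (ℕ → ℝ)) × (ℕ → ℝ) =>
      expFun u (t * ∑ j ∈ Finset.range w.1.1, A (w.1.2 j) * w.2 j))
      (κ.prod (Measure.infinitePi fun _ : ℕ => μ)) := by
    refine Integrable.of_bound hmeas.aestronglyMeasurable 1 ?_
    filter_upwards [ae_prod_infinitePi_of_ae hμ] with w hw
    refine norm_expFun_le ?_
    rw [mul_assoc, Finset.sum_mul]
    refine mul_nonpos_of_nonneg_of_nonpos ht (Finset.sum_nonpos fun j _ => ?_)
    rw [mul_assoc]
    exact mul_nonpos_of_nonneg_of_nonpos (hpos _).le (hw j)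
  rw [expTransform, smoothing, integral_map (measurable_smoothing_sum hA).aemeasurable
    (continuous_expFun_mul u t).aestronglyMeasurable,
    integral_prod _ hint, branchOp]
  refine integral_congr_ae (ae_of_all _ fun z => ?_)
  simp only [expFun_sum, expTransform]
  rw [integral_infinitePi_prod_range (g := fun j x => expFun u (t * (A (z.2 j) * x)))
    z.1 (fun j => by have := (continuous_expFun u).measurable; fun_prop)]
  simp only [mul_assoc]

end TIBRW

namespace TIBRW

/-! ### Fixed points of the smoothing transform -/

variable {κ : Measure (ℕ × (ℕ → ℝ))} {A : ℝ → ℝ} {δ m C : ℝ}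

theorem branchOp_congr (hpos : ∀ x, 0 < A x) {f g : ℝ → ℂ} (h : ∀ t, 0 ≤ t → f t = g t) {t : ℝ}
    (ht : 0 ≤ t) : branchOp κ A f t = branchOp κ A g t := by
  refine integral_congr_ae (ae_of_all _ fun z => Finset.prod_congr rfl fun j _ => ?_)
  exact h _ (mul_nonneg ht (hpos _).le)

theorem iterate_branchOp_of_fixed (hpos : ∀ x, 0 < A x) {f : ℝ → ℂ}
    (h : ∀ t, 0 ≤ t → branchOp κ A f t = f t) (n : ℕ) {t : ℝ} (ht : 0 ≤ t) :
    (branchOp κ A)^[n] f t = f t := by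
  induction n generalizing t with
  | zero => rfl
  | succ n ih =>
    rw [Function.iterate_succ_apply', branchOp_congr hpos (fun s hs => ih hs) ht, h t ht]

theorem charFun_eq_expTransform (μ : Measure ℝ) (t : ℝ) :
    charFun μ t = expTransform Complex.I μ t := by
  rw [charFun_apply_real, expTransform]
  simp [expFun]

/-- Negative arguments follow by complex conjugation; half a line is all the positive weights
require. -/
theorem ext_of_expTransform_I {μ ν : Measure ℝ} [IsFiniteMeasure μ] [IsFiniteMeasure ν]
    (h : ∀ t, 0 ≤ t → expTransform Complex.I μ t = expTransform Complex.I ν t) : μ = ν := by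
  refine Measure.ext_of_charFun (funext fun t => ?_)
  rcases le_total 0 t with ht | ht
  · rw [charFun_eq_expTransform, charFun_eq_expTransform, h t ht]
  · rw [← neg_neg t, charFun_neg (-t), charFun_neg (-t), charFun_eq_expTransform, charFun_eq_expTransform,
      h (-t) (by linarith)]

/-- Two laws of mean `1` have transforms agreeing to first order at `0`, so iteration brings them
together, while being fixed keeps their difference constant. Characteristic functions are used
because neither law is assumed to live on `[0, ∞)`. -/
theorem expTransform_I_eq_of_fixed (hw : IsWeight κ A δ m C) (hδ : 0 < δ) (hm : 0 ≤ m)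
    (hm1 : m < 1) {μ ν : Measure ℝ} [IsProbabilityMeasure μ] [IsProbabilityMeasure ν]
    (hμi : Integrable (fun x : ℝ => x) μ) (hμ1 : ∫ x, x ∂μ = 1)
    (hνi : Integrable (fun x : ℝ => x) ν) (hν1 : ∫ x, x ∂ν = 1)
    (hμ : ∀ t, 0 ≤ t →
      branchOp κ A (expTransform Complex.I μ) t = expTransform Complex.I μ t)
    (hν : ∀ t, 0 ≤ t →
      branchOp κ A (expTransform Complex.I ν) t = expTransform Complex.I ν t) : μ = ν := by
  refine ext_of_expTransform_I fun t ht => ?_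
  have hI : Complex.I.re ≤ 0 := by simp
  have had : ∀ ρ : Measure ℝ, ∀ᵐ x ∂ρ, x * Complex.I.re ≤ 0 := fun ρ => by simp
  have h := tendsto_iterate_branchOp_sub hw hm hm1
    (f := fun _ => expTransform Complex.I μ) (g := expTransform Complex.I ν)
    (fun _ => unitBdd_expTransform (had μ)) (unitBdd_expTransform (had ν)) ?_ tendsto_id ht
  · simp only [iterate_branchOp_of_fixed hw.pos hμ _ ht,
      iterate_branchOp_of_fixed hw.pos hν _ ht] at h
    exact sub_eq_zero.1 (tendsto_nhds_unique tendsto_const_nhds h)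
  · intro ε hε
    obtain ⟨b, hb, h1⟩ := expTransform_near_expFun hδ hI Complex.norm_I (had μ) hμi hμ1
      (half_pos hε)
    obtain ⟨b', hb', h2⟩ := expTransform_near_expFun hδ hI Complex.norm_I (had ν) hνi hν1
      (half_pos hε)
    refine ⟨b + b', by positivity, fun _ s hs => ?_⟩
    have h3 := h1 s hs
    have h4 := h2 s hs
    rw [norm_sub_rev] at h4
    have h5 := norm_sub_le_norm_sub_add_norm_sub (expTransform Complex.I μ s)
      (expFun Complex.I s) (expTransform Complex.I ν s)
    linarith

theorem ae_nonneg_of_tendsto {ι : Type*} {U : Filter ι} [U.NeBot] {μ : ι → ProbabilityMeasure ℝ}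
    {D : ProbabilityMeasure ℝ} (h : Tendsto μ U (𝓝 D))
    (hμ : ∀ n, ∀ᵐ x ∂(μ n : Measure ℝ), 0 ≤ x) : ∀ᵐ x ∂(D : Measure ℝ), 0 ≤ x := by
  -- A bounded continuous test function that vanishes exactly on `[0, ∞)`.
  let g : BoundedContinuousFunction ℝ ℝ := BoundedContinuousFunction.ofNormedAddCommGroup
    (fun x : ℝ => min 1 (max (-x) 0)) (by fun_prop) 1 fun x => by
      rw [Real.norm_of_nonneg (le_min zero_le_one (le_max_right _ _))]
      exact min_le_left _ _
  have h1 := (ProbabilityMeasure.tendsto_iff_forall_integral_tendsto.1 h) g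
  have h2 : ∀ n, ∫ x, g x ∂(μ n : Measure ℝ) = 0 := fun n => by
    refine integral_eq_zero_of_ae ?_
    filter_upwards [hμ n] with x hx
    simp [g, BoundedContinuousFunction.coe_ofNormedAddCommGroup, hx]
  simp only [h2] at h1
  have h3 : ∫ x, g x ∂(D : Measure ℝ) = 0 := (tendsto_nhds_unique tendsto_const_nhds h1).symm
  have h4 := (integral_eq_zero_iff_of_nonneg
    (fun x => le_min zero_le_one (le_max_right _ _)) (g.integrable _)).1 h3
  filter_upwards [h4] with x hx
  by_contra hneg
  have hneg : x < 0 := not_le.1 hneg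
  have h5 : 0 < min 1 (max (-x) 0) := lt_min one_pos (lt_max_of_lt_left (by linarith))
  exact h5.ne' hx

theorem ae_mul_re_nonpos {μ : Measure ℝ} (hμ : ∀ᵐ x ∂μ, 0 ≤ x) {u : ℂ} (hu : u.re ≤ 0) :
    ∀ᵐ x ∂μ, x * u.re ≤ 0 :=
  hμ.mono fun _ hx => mul_nonpos_of_nonneg_of_nonpos hx hu

theorem tendsto_expTransform {ι : Type*} {U : Filter ι} {μ : ι → ProbabilityMeasure ℝ}
    {D : ProbabilityMeasure ℝ} (h : Tendsto μ U (𝓝 D))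
    (hμ : ∀ n, ∀ᵐ x ∂(μ n : Measure ℝ), 0 ≤ x) (hD : ∀ᵐ x ∂(D : Measure ℝ), 0 ≤ x) {u : ℂ}
    (hu : u.re ≤ 0) {t : ℝ} (ht : 0 ≤ t) :
    Tendsto (fun n => expTransform u (μ n) t) U (𝓝 (expTransform u D t)) := by
  -- Truncating with `max x 0` makes the integrand bounded on all of `ℝ` without changing its
  -- integral against laws on `[0, ∞)`.
  let g : BoundedContinuousFunction ℝ ℂ := BoundedContinuousFunction.ofNormedAddCommGroup
    (fun x : ℝ => expFun u (t * max x 0))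
    ((continuous_expFun_mul u t).comp (continuous_id.max continuous_const)) 1 fun x =>
      norm_expFun_le (mul_nonpos_of_nonneg_of_nonpos (mul_nonneg ht (le_max_right _ _)) hu)
  have h1 := ((ProbabilityMeasure.tendsto_iff_forall_integral_rclike_tendsto ℂ).1 h) g
  have h2 : ∀ ν : Measure ℝ, (∀ᵐ x ∂ν, 0 ≤ x) → ∫ x, g x ∂ν = expTransform u ν t := fun ν hν => by
    refine integral_congr_ae ?_
    filter_upwards [hν] with x hx
    simp [g, BoundedContinuousFunction.coe_ofNormedAddCommGroup, hx]
  simpa only [h2 _ hD, h2 _ (hμ _)] using h1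

/-- A law on `[0, ∞)` whose Laplace transform is `1 - t + O(t ^ (1 + δ))` has mean `1`. -/
theorem mean_eq_one_of_laplace {μ : Measure ℝ} [IsProbabilityMeasure μ] (hμ : ∀ᵐ x ∂μ, 0 ≤ x)
    (hδ : 0 < δ) {B : ℝ}
    (hB : ∀ t, 0 ≤ t → ‖expTransform (-1) μ t - expFun (-1) t‖ ≤ B * t ^ (1 + δ)) :
    Integrable (fun x : ℝ => x) μ ∧ ∫ x, x ∂μ = 1 := by
  set L : ℝ → ℝ := fun t => ∫ x, Real.exp (-(t * x)) ∂μ with hL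
  have hLc : ∀ t, expTransform (-1) μ t = L t := fun t => by
    rw [hL, ← integral_complex_ofReal]
    refine integral_congr_ae (ae_of_all _ fun x => ?_)
    simp [expFun]
  have hec : ∀ t, expFun (-1) t = (Real.exp (-t) : ℝ) := fun t => by simp [expFun]
  have hLB : ∀ t, 0 ≤ t → |L t - Real.exp (-t)| ≤ B * t ^ (1 + δ) := fun t ht => by
    have h := hB t ht
    rw [hLc, hec, ← Complex.ofReal_sub, Complex.norm_real, Real.norm_eq_abs] at h
    exact h
  have hexpi : ∀ t : ℝ, 0 ≤ t → Integrable (fun x : ℝ => Real.exp (-(t * x))) μ := fun t ht => by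
    refine Integrable.of_bound (by fun_prop) 1 ?_
    filter_upwards [hμ] with x hx
    rw [Real.norm_of_nonneg (Real.exp_pos _).le, Real.exp_le_one_iff]
    nlinarith
  set s : ℕ → ℝ := fun n => ((n : ℝ) + 1)⁻¹ with hs
  have hs0 : ∀ n, 0 < s n := fun n => by positivity
  have hslim : Tendsto s atTop (𝓝 0) :=
    (tendsto_one_div_add_atTop_nhds_zero_nat (𝕜 := ℝ)).congr fun n => by simp [hs]
  have hderiv : ∀ x : ℝ, Tendsto (fun n => (1 - Real.exp (-(s n * x))) / s n) atTop (𝓝 x) := by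
    intro x
    have h1 : HasDerivAt (fun t : ℝ => -Real.exp (-(t * x))) x 0 := by
      have h2 : HasDerivAt (fun t : ℝ => -(t * x)) (-(1 * x)) 0 :=
        ((hasDerivAt_id (0 : ℝ)).mul_const x).neg
      simpa using h2.exp.fun_neg
    have h2 := h1.tendsto_slope_zero.comp (tendsto_nhdsWithin_iff.2
      ⟨hslim, Eventually.of_forall fun n => (hs0 n).ne'⟩)
    refine h2.congr fun n => ?_
    simp only [Function.comp_apply, zero_add, zero_mul, neg_zero, Real.exp_zero, smul_eq_mul]
    rw [inv_mul_eq_div]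
    ring
  have hval : ∀ n, ∫ x, (1 - Real.exp (-(s n * x))) / s n ∂μ = (1 - L (s n)) / s n := fun n => by
    rw [integral_div, integral_sub (integrable_const _) (hexpi _ (hs0 n).le)]
    simp [hL]
  -- The quotient `(1 - e^{-s}) / s` tends to `1`, and replacing `e^{-s}` by the Laplace transform
  -- costs at most `B s ^ δ`.
  have hvlim : Tendsto (fun n => (1 - L (s n)) / s n) atTop (𝓝 1) := by
    have h1 : Tendsto (fun n => (Real.exp (-(s n * 1)) - L (s n)) / s n) atTop (𝓝 0) := by
      have h2 : Tendsto (fun n => B * s n ^ δ) atTop (𝓝 0) := by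
        have := ((Real.continuousAt_rpow_const 0 δ (Or.inr hδ.le)).tendsto.comp hslim).const_mul B
        simpa [Real.zero_rpow hδ.ne'] using this
      refine squeeze_zero_norm (fun n => ?_) h2
      have h3 := hLB (s n) (hs0 n).le
      rw [norm_div, Real.norm_of_nonneg (hs0 n).le, Real.norm_eq_abs, abs_sub_comm, mul_one,
        div_le_iff₀ (hs0 n)]
      rw [Real.rpow_add (hs0 n), Real.rpow_one] at h3
      linarith
    have h2 := (hderiv 1).add h1
    rw [add_zero] at h2
    refine h2.congr fun n => ?_
    rw [← add_div]
    ring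
  have hnn : ∀ n, ∀ᵐ x ∂μ, 0 ≤ (1 - Real.exp (-(s n * x))) / s n := fun n => by
    filter_upwards [hμ] with x hx
    refine div_nonneg (sub_nonneg.2 (Real.exp_le_one_iff.2 ?_)) (hs0 n).le
    have := mul_nonneg (hs0 n).le hx
    linarith
  have hi : ∀ n, Integrable (fun x => (1 - Real.exp (-(s n * x))) / s n) μ := fun n =>
    ((integrable_const _).sub (hexpi _ (hs0 n).le)).div_const _
  -- Fatou: the quotients `(1 - e^{-s x}) / s` converge to `x` and their means converge to `1`. Once
  -- `x` is integrable it dominates them, which gives the exact mean.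
  have hint : Integrable (fun x : ℝ => x) μ := by
    refine ⟨measurable_id.aestronglyMeasurable, ?_⟩
    rw [hasFiniteIntegral_iff_ofReal hμ]
    have h1 : ∫⁻ x, ENNReal.ofReal x ∂μ
        ≤ liminf (fun n => ∫⁻ x, ENNReal.ofReal ((1 - Real.exp (-(s n * x))) / s n) ∂μ) atTop := by
      refine le_trans (le_of_eq ?_) (lintegral_liminf_le fun n => by fun_prop)
      refine lintegral_congr fun x => ?_
      exact ((ENNReal.continuous_ofReal.tendsto x).comp (hderiv x)).liminf_eq.symm
    refine lt_of_le_of_lt h1 ?_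
    have h2 : Tendsto (fun n => ∫⁻ x, ENNReal.ofReal ((1 - Real.exp (-(s n * x))) / s n) ∂μ) atTop
        (𝓝 (ENNReal.ofReal 1)) := by
      refine ((ENNReal.continuous_ofReal.tendsto 1).comp hvlim).congr fun n => ?_
      rw [Function.comp_apply, ← hval, ofReal_integral_eq_lintegral_ofReal (hi n) (hnn n)]
    rw [h2.liminf_eq]
    exact ENNReal.ofReal_lt_top
  refine ⟨hint, ?_⟩
  have hlim : Tendsto (fun n => ∫ x, (1 - Real.exp (-(s n * x))) / s n ∂μ) atTop
      (𝓝 (∫ x, x ∂μ)) := by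
    refine tendsto_integral_of_dominated_convergence (fun x => |x|)
      (fun n => (hi n).aestronglyMeasurable) hint.norm (fun n => ?_) (ae_of_all _ hderiv)
    filter_upwards [hμ, hnn n] with x hx hx'
    rw [Real.norm_of_nonneg hx', abs_of_nonneg hx, div_le_iff₀ (hs0 n)]
    have := Real.add_one_le_exp (-(s n * x))
    linarith
  simp only [hval] at hlim
  exact tendsto_nhds_unique hlim hvlim

theorem IsWeight.constant_nonneg (hw : IsWeight κ A δ m C) : 0 ≤ C :=
  le_trans (integral_nonneg fun z => Real.rpow_nonneg (weightSum_nonneg hw.pos z) _)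
    hw.weightSum_rpow_le

/-- The smoothing transform has a nonnegative fixed point of mean `1`. -/
theorem exists_fixedPoint (hw : IsWeight κ A δ m C) (hδ : 0 < δ) (hδ1 : δ ≤ 1) (hm : 0 ≤ m)
    (hm1 : m < 1) :
    ∃ D : ProbabilityMeasure ℝ, smoothing κ A D = D ∧ (∀ᵐ x ∂(D : Measure ℝ), 0 ≤ x) ∧
      Integrable (fun x : ℝ => x) (D : Measure ℝ) ∧ ∫ x, x ∂(D : Measure ℝ) = 1 := by
  have := hw.isProbabilityMeasure
  have hC := hw.constant_nonneg
  have hprob : ∀ n, IsProbabilityMeasure ((smoothing κ A)^[n] (Measure.dirac 1)) := fun n => by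
    induction n with
    | zero => exact Measure.dirac.isProbabilityMeasure
    | succ n ih =>
      rw [Function.iterate_succ_apply']
      exact isProbabilityMeasure_smoothing hw.measurable _
  set μ : ℕ → ProbabilityMeasure ℝ := fun n => ⟨_, hprob n⟩ with hμdef
  have hμ0 : ∀ n, ∀ᵐ x ∂(μ n : Measure ℝ), 0 ≤ x := fun n => by
    induction n with
    | zero =>
      change ∀ᵐ x ∂(Measure.dirac (1 : ℝ)), 0 ≤ x
      rw [ae_dirac_iff measurableSet_Ici]
      exact zero_le_one
    | succ n ih =>
      change ∀ᵐ x ∂((smoothing κ A)^[n + 1] (Measure.dirac 1)), 0 ≤ x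
      rw [Function.iterate_succ_apply']
      exact ae_smoothing_nonneg hw.measurable hw.pos ih
  have hF : ∀ u : ℂ, u.re ≤ 0 → ∀ n, ∀ t, 0 ≤ t →
      expTransform u (μ n) t = (branchOp κ A)^[n] (expFun u) t := fun u hu n => by
    induction n with
    | zero =>
      intro t _
      change ∫ x, expFun u (t * x) ∂(Measure.dirac 1) = expFun u t
      rw [integral_dirac, mul_one]
    | succ n ih =>
      intro t ht
      change expTransform u ((smoothing κ A)^[n + 1] (Measure.dirac 1)) t = _
      rw [Function.iterate_succ_apply', Function.iterate_succ_apply']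
      change expTransform u (smoothing κ A (μ n)) t = _
      rw [expTransform_smoothing hw.measurable hw.pos (ae_mul_re_nonpos (hμ0 n) hu) ht]
      exact branchOp_congr hw.pos ih ht
  -- The first step moves `e^{t u}` by at most `3 (C + 1) t ^ (1 + δ)`, and each further step
  -- contracts that displacement by `m`.
  have hgeo : ∀ u : ℂ, u.re ≤ 0 → ‖u‖ = 1 → ∀ t, 0 ≤ t → ∀ n,
      dist (expTransform u (μ n) t) (expTransform u (μ (n + 1)) t)
        ≤ 3 * (C + 1) * t ^ (1 + δ) * m ^ n := fun u hu hu1 t ht n => by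
    rw [dist_comm, dist_eq_norm, hF u hu _ t ht, hF u hu _ t ht, Function.iterate_succ_apply]
    refine (iterate_branchOp_sub_le hw hm
      ((unitBdd_expFun hu).branchOp hw.measurable hw.pos) (unitBdd_expFun hu) (a := 0)
      (b := 3 * (C + 1)) (by positivity) (fun s hs => ?_) n ht).trans_eq (by ring)
    simpa using norm_branchOp_expFun_sub_le hw hδ hδ1 hu hu1 hs
  have hIre : Complex.I.re ≤ 0 := by simp
  have hconv : ∀ t, ∃ l, Tendsto (fun n => charFun (μ n : Measure ℝ) t) atTop (𝓝 l) := fun t => by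
    have hpos : ∀ t, 0 ≤ t → ∃ l, Tendsto (fun n => charFun (μ n : Measure ℝ) t) atTop (𝓝 l) :=
      fun t ht => by
        simp only [charFun_eq_expTransform]
        exact cauchySeq_tendsto_of_complete
          (cauchySeq_of_le_geometric m _ hm1 (hgeo _ hIre Complex.norm_I t ht))
    rcases le_total 0 t with ht | ht
    · exact hpos t ht
    · obtain ⟨l, hl⟩ := hpos (-t) (by linarith)
      refine ⟨starRingEnd ℂ l, ?_⟩
      rw [← neg_neg t]
      simp only [charFun_neg (-t)]
      exact (Complex.continuous_conj.tendsto l).comp hl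
  choose ψ hψ using hconv
  have hlimit : ∀ u : ℂ, u.re ≤ 0 → ‖u‖ = 1 → ∀ t, 0 ≤ t → ∀ l : ℂ,
      Tendsto (fun n => expTransform u (μ n) t) atTop (𝓝 l) → ∀ n,
      ‖expTransform u (μ n) t - l‖ ≤ 3 * (C + 1) / (1 - m) * m ^ n * t ^ (1 + δ) :=
    fun u hu hu1 t ht l hl n => by
      have h := dist_le_of_le_geometric_of_tendsto m _ hm1 (hgeo u hu hu1 t ht) hl n
      rw [dist_eq_norm] at h
      exact h.trans_eq (by ring)
  have hzero : ∀ u t, expTransform u (μ 0) t = expFun u t := fun u t => by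
    change ∫ x, expFun u (t * x) ∂(Measure.dirac 1) = expFun u t
    rw [integral_dirac, mul_one]
  have hψb : ∀ t, ‖ψ t - expFun Complex.I t‖ ≤ 3 * (C + 1) / (1 - m) * |t| ^ (1 + δ) := by
    have hpos : ∀ t, 0 ≤ t →
        ‖ψ t - expFun Complex.I t‖ ≤ 3 * (C + 1) / (1 - m) * |t| ^ (1 + δ) := fun t ht => by
      have h1 := hψ t
      simp only [charFun_eq_expTransform] at h1
      have h := hlimit _ hIre Complex.norm_I t ht _ h1 0
      rw [hzero, norm_sub_rev] at h
      simpa [abs_of_nonneg ht] using h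
    intro t
    rcases le_total 0 t with ht | ht
    · exact hpos t ht
    · have h1 : Tendsto (fun n => charFun (μ n : Measure ℝ) t) atTop
          (𝓝 (starRingEnd ℂ (ψ (-t)))) := by
        refine ((Complex.continuous_conj.tendsto _).comp (hψ (-t))).congr fun n => ?_
        rw [Function.comp_apply, charFun_neg, Complex.conj_conj]
      have h2 : ψ t = starRingEnd ℂ (ψ (-t)) := tendsto_nhds_unique (hψ t) h1
      have h3 : expFun Complex.I t = starRingEnd ℂ (expFun Complex.I (-t)) := by
        simp [expFun, ← Complex.exp_conj]
      rw [h2, h3, ← map_sub, Complex.norm_conj, ← abs_neg]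
      exact hpos (-t) (by linarith)
  have hψ0 : ψ 0 = 1 := by
    have h := hψb 0
    rw [abs_zero, Real.zero_rpow (by linarith), mul_zero] at h
    have h2 := sub_eq_zero.1 (norm_le_zero_iff.1 h)
    simpa [expFun] using h2
  -- Continuity at `0` of the limit of the characteristic functions yields tightness, by Lévy's
  -- criterion.
  have hcont : ContinuousAt ψ 0 := by
    have h1 : Tendsto (fun t => ψ t - expFun Complex.I t) (𝓝 0) (𝓝 0) := by
      refine squeeze_zero_norm hψb ?_
      have h2 : ContinuousAt (fun t : ℝ => 3 * (C + 1) / (1 - m) * |t| ^ (1 + δ)) 0 :=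
        (continuous_abs.continuousAt.rpow_const (Or.inr (by linarith))).const_mul _
      have h3 := h2.tendsto
      rwa [abs_zero, Real.zero_rpow (by linarith), mul_zero] at h3
    have h2 := h1.add ((continuous_expFun Complex.I).tendsto 0)
    have h3 : expFun Complex.I 0 = 1 := by simp [expFun]
    rw [h3, zero_add] at h2
    rw [ContinuousAt, hψ0]
    simpa using h2
  have htight := isTightMeasureSet_of_tendsto_charFun (μ := fun n => (μ n : Measure ℝ)) hcont hψ
  have hcpt : IsCompact (closure (Set.range μ)) := by
    refine isCompact_closure_of_isTightMeasureSet (htight.subset ?_)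
    rintro _ ⟨_, ⟨n, rfl⟩, rfl⟩
    exact ⟨n, rfl⟩
  -- A limit along a free ultrafilter replaces the extraction of a subsequence; the transforms
  -- already converge along the whole sequence, so their limits are those of `D`.
  obtain ⟨D, -, hD⟩ := hcpt.ultrafilter_le_nhds ((hyperfilter ℕ).map μ) (by
    rw [Ultrafilter.coe_map, le_principal_iff]
    exact mem_map.2 (univ_mem' fun n => subset_closure ⟨n, rfl⟩))
  have hDt : Tendsto μ (hyperfilter ℕ : Filter ℕ) (𝓝 D) := hD
  have hD0 := ae_nonneg_of_tendsto hDt hμ0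
  -- Weak convergence alone does not preserve the mean. The bound `O(t ^ (1 + δ))` on the Laplace
  -- transforms passes to the limit and does.
  have hlapl := mean_eq_one_of_laplace hD0 hδ (B := 3 * (C + 1) / (1 - m)) fun t ht => by
    have hu : (-1 : ℂ).re ≤ 0 := by simp
    have hu1 : ‖(-1 : ℂ)‖ = 1 := by simp
    obtain ⟨l, hl⟩ := cauchySeq_tendsto_of_complete
      (cauchySeq_of_le_geometric m _ hm1 (hgeo _ hu hu1 t ht))
    have h1 := tendsto_nhds_unique (hl.mono_left Nat.hyperfilter_le_atTop)
      (tendsto_expTransform hDt hμ0 hD0 hu ht)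
    have h2 := hlimit _ hu hu1 t ht l hl 0
    rw [hzero, norm_sub_rev, h1] at h2
    simpa using h2
  refine ⟨D, ?_, hD0, hlapl⟩
  have hψD : ∀ t, 0 ≤ t →
      Tendsto (fun n => expTransform Complex.I (μ n) t) atTop (𝓝 (expTransform Complex.I D t)) :=
    fun t ht => by
      have h1 := hψ t
      simp only [charFun_eq_expTransform] at h1
      rwa [tendsto_nhds_unique (h1.mono_left Nat.hyperfilter_le_atTop)
        (tendsto_expTransform hDt hμ0 hD0 hIre ht)] at h1
  have := isProbabilityMeasure_smoothing (κ := κ) hw.measurable (D : Measure ℝ)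
  refine ext_of_expTransform_I fun t ht => ?_
  have had := ae_mul_re_nonpos hD0 hIre
  rw [expTransform_smoothing hw.measurable hw.pos had ht]
  -- The transform of `μ (n + 1)` tends to that of `D`, being a shifted sequence, and also to its
  -- image under `branchOp`, because the distance of `μ n` to `D` contracts geometrically.
  refine tendsto_nhds_unique ?_ ((tendsto_add_atTop_iff_nat 1).2 (hψD t ht))
  rw [tendsto_iff_norm_sub_tendsto_zero]
  have h1 : Tendsto (fun n : ℕ => 3 * (C + 1) / (1 - m) * m ^ n * m * t ^ (1 + δ)) atTop
      (𝓝 (3 * (C + 1) / (1 - m) * 0 * m * t ^ (1 + δ))) :=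
    (((tendsto_pow_atTop_nhds_zero_of_lt_one hm hm1).const_mul _).mul_const m).mul_const _
  simp only [mul_zero, zero_mul] at h1
  refine squeeze_zero_norm (fun n => ?_) h1
  rw [norm_norm, hF _ hIre _ t ht, Function.iterate_succ_apply',
    ← branchOp_congr hw.pos (hF _ hIre n) ht]
  refine (branchOp_sub_le hw (unitBdd_expTransform (ae_mul_re_nonpos (hμ0 n) hIre))
    (unitBdd_expTransform had) (a := 0) (b := 3 * (C + 1) / (1 - m) * m ^ n) ?_ ?_ ht).trans_eq
    (by ring)
  · have : 0 < 1 - m := by linarith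
    positivity
  · intro s hs
    simpa using hlimit _ hIre Complex.norm_I s hs _ (hψD s hs) n

/-- A nonnegative fixed point of mean `1` has no atom at `0`. -/
theorem ae_pos_of_fixed [IsProbabilityMeasure κ] (hA : Measurable A) (hpos : ∀ x, 0 < A x)
    (hN : ∀ᵐ z ∂κ, 1 ≤ z.1) (hN1 : ¬ ∀ᵐ z ∂κ, z.1 = 1) {μ : Measure ℝ} [IsProbabilityMeasure μ]
    (hfix : smoothing κ A μ = μ) (hμ : ∀ᵐ x ∂μ, 0 ≤ x) (hmean : ∫ x, x ∂μ = 1) :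
    ∀ᵐ x ∂μ, 0 < x := by
  classical
  set q : ℝ := μ.real {0} with hq
  have hq0 : 0 ≤ q := measureReal_nonneg
  have hq1 : q ≤ 1 := measureReal_le_one
  set χ : ℝ → ℂ := fun x => if x = 0 then 1 else 0 with hχ
  have hχm : Measurable χ := Measurable.ite (measurableSet_singleton 0) measurable_const
    measurable_const
  have hχi : ∫ x, χ x ∂μ = q := by
    have h : χ = fun x => (((({0} : Set ℝ).indicator 1 x : ℝ)) : ℂ) := by
      funext x
      by_cases hx : x = 0 <;> simp [hχ, hx]
    rw [h, integral_complex_ofReal, integral_indicator_one (measurableSet_singleton 0)]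
  -- A sum of nonnegative terms with positive weights vanishes exactly when every `Δ_j` does.
  have hprod : ∀ᵐ w ∂κ.prod (Measure.infinitePi fun _ : ℕ => μ),
      χ (∑ j ∈ Finset.range w.1.1, A (w.1.2 j) * w.2 j)
        = ∏ j ∈ Finset.range w.1.1, χ (w.2 j) := by
    filter_upwards [ae_prod_infinitePi_of_ae hμ] with w hw
    simp only [hχ, Finset.prod_ite_zero, Finset.prod_const_one]
    refine if_congr ?_ rfl rfl
    rw [Finset.sum_eq_zero_iff_of_nonneg fun j _ => mul_nonneg (hpos _).le (hw j)]
    simp [(hpos _).ne']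
  have hpm : Measurable fun w : (ℕ × (ℕ → ℝ)) × (ℕ → ℝ) => ∏ j ∈ Finset.range w.1.1, χ (w.2 j) :=
    measurable_of_measurable_slices (N := fun w : (ℕ × (ℕ → ℝ)) × (ℕ → ℝ) => w.1.1)
      (F := fun m w => ∏ j ∈ Finset.range m, χ (w.2 j))
      (measurable_fst.comp measurable_fst) fun _ => Finset.measurable_prod _ fun j _ =>
        hχm.comp ((measurable_pi_apply j).comp measurable_snd)
  have hpi : Integrable (fun w : (ℕ × (ℕ → ℝ)) × (ℕ → ℝ) =>
      ∏ j ∈ Finset.range w.1.1, χ (w.2 j)) (κ.prod (Measure.infinitePi fun _ : ℕ => μ)) := by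
    refine Integrable.of_bound hpm.aestronglyMeasurable 1 (ae_of_all _ fun w => ?_)
    rw [norm_prod]
    refine Finset.prod_le_one (fun _ _ => norm_nonneg _) fun j _ => ?_
    simp only [hχ]
    split_ifs <;> simp
  -- The mass at `0` is a fixed point of the generating function of `N`.
  have hqeq : ∫ z, q ^ z.1 ∂κ = q := by
    have h : ((∫ z, q ^ z.1 ∂κ : ℝ) : ℂ) = q := by
      calc ((∫ z, q ^ z.1 ∂κ : ℝ) : ℂ) = ∫ z, (q : ℂ) ^ z.1 ∂κ := by
            rw [← integral_complex_ofReal]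
            simp only [Complex.ofReal_pow]
        _ = ∫ z, ∫ y, ∏ j ∈ Finset.range z.1, χ (y j)
              ∂(Measure.infinitePi fun _ : ℕ => μ) ∂κ := by
            refine integral_congr_ae (ae_of_all _ fun z => ?_)
            simp only
            rw [integral_infinitePi_prod_range z.1 (g := fun _ => χ) fun _ => hχm]
            simp [hχi]
        _ = ∫ w, χ (∑ j ∈ Finset.range w.1.1, A (w.1.2 j) * w.2 j)
              ∂κ.prod (Measure.infinitePi fun _ : ℕ => μ) := by
            rw [← integral_prod _ hpi]
            exact integral_congr_ae (hprod.mono fun w hw => hw.symm)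
        _ = ∫ x, χ x ∂(smoothing κ A μ) := by
            rw [smoothing, integral_map (measurable_smoothing_sum hA).aemeasurable
              hχm.aestronglyMeasurable]
        _ = q := by rw [hfix, hχi]
    exact_mod_cast h
  have hqm : Measurable fun z : ℕ × (ℕ → ℝ) => q ^ z.1 :=
    measurable_of_measurable_slices (F := fun m (_ : ℕ × (ℕ → ℝ)) => q ^ m) measurable_fst
      fun _ => measurable_const
  have hqi : Integrable (fun z : ℕ × (ℕ → ℝ) => q ^ z.1) κ := by
    refine Integrable.of_bound hqm.aestronglyMeasurable 1 (ae_of_all _ fun z => ?_)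
    rw [Real.norm_of_nonneg (pow_nonneg hq0 _)]
    exact pow_le_one₀ hq0 hq1
  have hae : ∀ᵐ z ∂κ, q - q ^ z.1 = 0 := by
    refine (integral_eq_zero_iff_of_nonneg_ae ?_ ((integrable_const q).sub hqi)).1 ?_
    · filter_upwards [hN] with z hz
      exact sub_nonneg.2 (pow_le_of_le_one hq0 hq1 (by omega))
    · change ∫ z : ℕ × (ℕ → ℝ), (q - q ^ z.1) ∂κ = 0
      rw [integral_sub (integrable_const q) hqi, hqeq]
      simp
  -- Since `N ≥ 1`, equality of means forces `q ^ N = q` almost surely; for `0 < q < 1` this would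
  -- mean `N = 1` almost surely. The value `1` is then excluded by the mean.
  have hq_cases : q = 0 ∨ q = 1 := by
    by_contra hcon
    rw [not_or] at hcon
    refine hN1 ?_
    filter_upwards [hae] with z hz
    have h1 : q ^ z.1 = q ^ 1 := by rw [pow_one]; linarith
    exact pow_right_injective₀ (lt_of_le_of_ne hq0 (Ne.symm hcon.1)) hcon.2 h1
  have hqz : q = 0 := by
    refine hq_cases.resolve_right fun h1 => ?_
    have h2 : ∀ᵐ x ∂μ, x = 0 := by
      have h3 : μ {0} = 1 := by
        rw [hq, measureReal_def] at h1
        exact (ENNReal.toReal_eq_one_iff _).1 h1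
      exact (prob_compl_eq_zero_iff (measurableSet_singleton 0)).2 h3
    rw [integral_eq_zero_of_ae h2] at hmean
    exact zero_ne_one hmean
  have hne : ∀ᵐ x ∂μ, x ≠ 0 := by
    have h1 : μ {0} = 0 := (measureReal_eq_zero_iff).1 hqz
    exact measure_eq_zero_iff_ae_notMem.1 h1
  filter_upwards [hμ, hne] with x hx hx'
  exact lt_of_le_of_ne hx (Ne.symm hx')

end TIBRW

namespace TIBRW

/-! ### Enumerations of a point process -/

theorem pointMeasure_apply (n : ℕ) (x : ℕ → ℝ) {s : Set ℝ} (hs : MeasurableSet s) :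
    pointMeasure n x s = ∑ j ∈ Finset.range n, s.indicator (1 : ℝ → ℝ≥0∞) (x j) := by
  simp [pointMeasure, Measure.coe_finsetSum, Finset.sum_apply, Measure.dirac_apply' _ hs]

theorem pointMeasure_univ (n : ℕ) (x : ℕ → ℝ) : pointMeasure n x Set.univ = n := by
  simp [pointMeasure_apply]

theorem lintegral_pointMeasure (n : ℕ) (x : ℕ → ℝ) {f : ℝ → ℝ≥0∞} (hf : Measurable f) :
    ∫⁻ y, f y ∂(pointMeasure n x) = ∑ j ∈ Finset.range n, f (x j) := by
  simp [pointMeasure, lintegral_dirac' _ hf]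

/-- `∏_{x ∈ z} s(x)` for a simple function `s`, as a function of the measure `z`. -/
noncomputable def simpleProd (s : SimpleFunc ℝ ℂ) (z : Measure ℝ) : ℂ :=
  ∏ c ∈ s.range, c ^ ⌊(z (s ⁻¹' {c})).toReal⌋₊

theorem measurable_simpleProd (s : SimpleFunc ℝ ℂ) : Measurable (simpleProd s) := by
  refine Finset.measurable_prod _ fun c _ => ?_
  have h : Measurable fun z : Measure ℝ => ⌊(z (s ⁻¹' {c})).toReal⌋₊ :=
    Nat.measurable_floor.comp
      (ENNReal.measurable_toReal.comp (Measure.measurable_coe (s.measurableSet_fiber c)))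
  exact (measurable_from_top (f := fun n : ℕ => c ^ n)).comp h

/-- Grouping the factors by their value leaves, as exponents, the numbers of points in the fibres,
which the point measure itself records without any enumeration. -/
theorem simpleProd_pointMeasure (s : SimpleFunc ℝ ℂ) (n : ℕ) (x : ℕ → ℝ) :
    simpleProd s (pointMeasure n x) = ∏ j ∈ Finset.range n, s (x j) := by
  classical
  have hcard : ∀ c, ⌊(pointMeasure n x (s ⁻¹' {c})).toReal⌋₊
      = ((Finset.range n).filter fun j => s (x j) = c).card := fun c => by
    have h : pointMeasure n x (s ⁻¹' {c})
        = (((Finset.range n).filter fun j => s (x j) = c).card : ℝ≥0∞) := by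
      rw [pointMeasure_apply _ _ (s.measurableSet_fiber c), Finset.card_filter, Nat.cast_sum]
      refine Finset.sum_congr rfl fun j _ => ?_
      by_cases hj : s (x j) = c <;> simp [hj]
    rw [h, ENNReal.toReal_natCast, Nat.floor_natCast]
  rw [simpleProd, ← Finset.prod_fiberwise_of_maps_to (t := s.range) (g := fun j => s (x j))
    (fun j _ => s.mem_range_self (x j))]
  refine Finset.prod_congr rfl fun c _ => ?_
  rw [hcard, Finset.prod_congr rfl fun j hj => (Finset.mem_filter.1 hj).2, Finset.prod_const]

theorem measurable_prod_range {g : ℝ → ℂ} (hg : Measurable g) :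
    Measurable fun z : ℕ × (ℕ → ℝ) => ∏ j ∈ Finset.range z.1, g (z.2 j) :=
  measurable_of_measurable_slices
    (F := fun n (z : ℕ × (ℕ → ℝ)) => ∏ j ∈ Finset.range n, g (z.2 j)) measurable_fst
    fun _ => Finset.measurable_prod _ fun j _ => hg.comp ((measurable_pi_apply j).comp measurable_snd)

variable {κ κ' : Measure (ℕ × (ℕ → ℝ))} {ζ : Measure (Measure ℝ)}

/-- `𝔼 ∏_{j < N} g(ξ_j)` only depends on the law of the point process `∑_{j < N} δ_{ξ_j}`. -/
theorem IsEnumeration.integral_prod_eq (hκ : IsEnumeration κ ζ) (hκ' : IsEnumeration κ' ζ)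
    {g : ℝ → ℂ} (hg : Measurable g) (hg1 : ∀ x, ‖g x‖ ≤ 1) :
    ∫ z, ∏ j ∈ Finset.range z.1, g (z.2 j) ∂κ = ∫ z, ∏ j ∈ Finset.range z.1, g (z.2 j) ∂κ' := by
  -- For simple functions the product is a measurable function of the point measure; bounded
  -- approximation and dominated convergence reach `g`.
  set s : ℕ → SimpleFunc ℝ ℂ := hg.stronglyMeasurable.approxBounded 1 with hs
  have hs1 : ∀ n x, ‖s n x‖ ≤ 1 := fun n x =>
    hg.stronglyMeasurable.norm_approxBounded_le zero_le_one n x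
  have hlim : ∀ x, Tendsto (fun n => s n x) atTop (𝓝 (g x)) := fun x =>
    hg.stronglyMeasurable.tendsto_approxBounded_of_norm_le (hg1 x)
  have key : ∀ ρ : Measure (ℕ × (ℕ → ℝ)), IsEnumeration ρ ζ →
      Tendsto (fun n => ∫ z, simpleProd (s n) z ∂ζ) atTop
        (𝓝 (∫ z, ∏ j ∈ Finset.range z.1, g (z.2 j) ∂ρ)) := fun ρ hρ => by
    have := hρ.isProbabilityMeasure
    have h1 : ∀ n, ∫ z, simpleProd (s n) z ∂ζ
        = ∫ z, ∏ j ∈ Finset.range z.1, s n (z.2 j) ∂ρ := fun n => by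
      rw [← hρ.map_eq, integral_map measurable_pointMeasure.aemeasurable
        (measurable_simpleProd (s n)).aestronglyMeasurable]
      simp only [simpleProd_pointMeasure]
    simp only [h1]
    refine tendsto_integral_of_dominated_convergence (fun _ => 1)
      (fun n => (measurable_prod_range (s n).measurable).aestronglyMeasurable)
      (integrable_const _) (fun n => ae_of_all _ fun z => ?_)
      (ae_of_all _ fun z => tendsto_finsetProd _ fun j _ => hlim _)
    rw [norm_prod]
    exact Finset.prod_le_one (fun _ _ => norm_nonneg _) fun j _ => hs1 n _
  exact tendsto_nhds_unique (key κ hκ) (key κ' hκ')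

theorem IsEnumeration.branchOp_eq (hκ : IsEnumeration κ ζ) (hκ' : IsEnumeration κ' ζ) {A : ℝ → ℝ}
    (hA : Measurable A) (hpos : ∀ x, 0 < A x) {f : ℝ → ℂ} (hf : UnitBdd f) {t : ℝ} (ht : 0 ≤ t) :
    branchOp κ A f t = branchOp κ' A f t :=
  hκ.integral_prod_eq hκ' (g := fun x => f (t * A x)) (hf.measurable.comp (hA.const_mul t))
    fun _ => hf.norm_le _ (mul_nonneg ht (hpos _).le)

theorem IsEnumeration.expMoment_eq (hκ : IsEnumeration κ ζ) (a : ℝ) :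
    expMoment ζ a
      = ∫⁻ z, ENNReal.ofReal (weightSum (fun x => Real.exp (a * x)) z) ∂κ := by
  have hm : Measurable fun x : ℝ => ENNReal.ofReal (Real.exp (a * x)) := by fun_prop
  rw [expMoment, ← hκ.map_eq, lintegral_map (Measure.measurable_lintegral hm)
    measurable_pointMeasure]
  refine lintegral_congr fun z => ?_
  rw [lintegral_pointMeasure _ _ hm, weightSum,
    ENNReal.ofReal_sum_of_nonneg fun _ _ => (Real.exp_pos _).le]

theorem IsEnumeration.integrable_expSum (hκ : IsEnumeration κ ζ) {a : ℝ}
    (h : expMoment ζ a < ∞) : Integrable (weightSum fun x => Real.exp (a * x)) κ := by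
  refine ⟨(measurable_weightSum (by fun_prop)).aestronglyMeasurable, ?_⟩
  rw [hasFiniteIntegral_iff_ofReal
    (ae_of_all _ fun z => weightSum_nonneg (fun _ => Real.exp_pos _) z), ← hκ.expMoment_eq]
  exact h

theorem IsEnumeration.integral_expSum (hκ : IsEnumeration κ ζ) {a : ℝ}
    (h0 : 0 < expMoment ζ a) (h : expMoment ζ a < ∞) :
    ∫ z, weightSum (fun x => Real.exp (a * x)) z ∂κ = Real.exp (nu ζ a) := by
  rw [integral_eq_lintegral_of_nonneg_ae
    (ae_of_all _ fun z => weightSum_nonneg (fun _ => Real.exp_pos _) z)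
    (measurable_weightSum (by fun_prop)).aestronglyMeasurable, ← hκ.expMoment_eq, nu,
    Real.exp_log (ENNReal.toReal_pos h0.ne' h.ne)]

theorem IsEnumeration.isProbabilityMeasure_law (hκ : IsEnumeration κ ζ) :
    IsProbabilityMeasure ζ := by
  have := hκ.isProbabilityMeasure
  rw [← hκ.map_eq]
  exact Measure.isProbabilityMeasure_map measurable_pointMeasure.aemeasurable

theorem measurable_apply_univ : Measurable fun z : Measure ℝ => z Set.univ :=
  Measure.measurable_coe MeasurableSet.univ

theorem measurableSet_one_le_card : MeasurableSet {z : Measure ℝ | 1 ≤ z Set.univ} :=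
  measurable_apply_univ measurableSet_Ici

theorem measurableSet_card_eq_one : MeasurableSet {z : Measure ℝ | z Set.univ = 1} :=
  measurable_apply_univ (measurableSet_singleton 1)

theorem Assumptions.ae_one_le [IsProbabilityMeasure ζ] (hA : Assumptions ζ) :
    ∀ᵐ z ∂ζ, 1 ≤ z Set.univ :=
  (prob_compl_eq_zero_iff measurableSet_one_le_card).2 hA.one_le_card

theorem Assumptions.not_ae_eq_one [IsProbabilityMeasure ζ] (hA : Assumptions ζ) :
    ¬ ∀ᵐ z ∂ζ, z Set.univ = 1 := fun h =>
  hA.card_nontrivial.ne ((prob_compl_eq_zero_iff measurableSet_card_eq_one).1 h)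

theorem IsEnumeration.ae_one_le (hκ : IsEnumeration κ ζ) (hA : Assumptions ζ) :
    ∀ᵐ z ∂κ, 1 ≤ z.1 := by
  have := hκ.isProbabilityMeasure_law
  have h := hA.ae_one_le
  rw [← hκ.map_eq, ae_map_iff measurable_pointMeasure.aemeasurable measurableSet_one_le_card] at h
  filter_upwards [h] with z hz
  rw [pointMeasure_univ] at hz
  exact_mod_cast hz

theorem IsEnumeration.not_ae_eq_one (hκ : IsEnumeration κ ζ) (hA : Assumptions ζ) :
    ¬ ∀ᵐ z ∂κ, z.1 = 1 := by
  have := hκ.isProbabilityMeasure_law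
  have h := hA.not_ae_eq_one
  rw [← hκ.map_eq, ae_map_iff measurable_pointMeasure.aemeasurable measurableSet_card_eq_one] at h
  refine fun h1 => h ?_
  filter_upwards [h1] with z hz
  rw [pointMeasure_univ, hz, Nat.cast_one]

/-! ### The log-Laplace transform -/

/-- `ζ.join` is the intensity measure of the point process. Seeing `ν` as its cumulant generating
function gives analyticity. -/
theorem nu_eq_cgf (ζ : Measure (Measure ℝ)) : nu ζ = cgf id ζ.join := by
  funext a
  have hm : Measurable fun x : ℝ => ENNReal.ofReal (Real.exp (a * x)) := by fun_prop
  rw [nu, cgf, mgf, integral_eq_lintegral_of_nonneg_ae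
    (ae_of_all _ fun x => (Real.exp_pos _).le) (by fun_prop)]
  congr 2
  exact (Measure.lintegral_join hm.aemeasurable).symm

theorem Assumptions.Ici_subset_interior (hA : Assumptions ζ) :
    Set.Ici (0 : ℝ) ⊆ interior (integrableExpSet id ζ.join) := by
  obtain ⟨ϑ, hϑ, h⟩ := hA.nu_finite
  have h1 : Set.Ioi (-ϑ) ⊆ integrableExpSet id ζ.join := fun a ha => by
    have hm : Measurable fun x : ℝ => ENNReal.ofReal (Real.exp (a * x)) := by fun_prop
    refine ⟨by fun_prop, ?_⟩
    rw [hasFiniteIntegral_iff_ofReal (ae_of_all _ fun x => (Real.exp_pos _).le)]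
    exact (Measure.lintegral_join hm.aemeasurable).trans_lt (h a ha).2
  exact fun a (ha : 0 ≤ a) =>
    interior_maximal h1 isOpen_Ioi (show -ϑ < a by linarith)

theorem Assumptions.analyticAt_nu (hA : Assumptions ζ) {a : ℝ} (ha : 0 ≤ a) :
    AnalyticAt ℝ (nu ζ) a := by
  rw [nu_eq_cgf]
  exact analyticAt_cgf (hA.Ici_subset_interior ha)

/-- `e^{ν(0)} = 𝔼 N`, which exceeds `1` because `N ≥ 1` and `N` is not almost surely `1`. -/
theorem Assumptions.nu_zero_pos [IsProbabilityMeasure ζ] (hA : Assumptions ζ) : 0 < nu ζ 0 := by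
  obtain ⟨ϑ, hϑ, h⟩ := hA.nu_finite
  have hfin := (h 0 (by linarith)).2
  have h0 : expMoment ζ 0 = ∫⁻ z, z Set.univ ∂ζ := by simp [expMoment]
  have h1 : 1 < expMoment ζ 0 := by
    by_contra hle
    rw [not_lt, h0] at hle
    refine hA.not_ae_eq_one ?_
    have h2 := ae_eq_of_ae_le_of_lintegral_le (μ := ζ) (f := fun _ => 1)
      (g := fun z => z Set.univ) hA.ae_one_le (by simp) measurable_apply_univ.aemeasurable
      (by simpa using hle)
    filter_upwards [h2] with z hz using hz.symm
  refine Real.log_pos ?_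
  have := (ENNReal.toReal_lt_toReal ENNReal.one_ne_top hfin.ne).2 h1
  simpa using this

/-- Below the critical value, `θ ν'(θ) < ν(θ)`. -/
theorem Assumptions.mul_deriv_nu_lt [IsProbabilityMeasure ζ] (hA : Assumptions ζ) {θ : ℝ}
    (hθ : 0 < θ) (hcrit : (θ : EReal) < thetaCrit ζ) : θ * deriv (nu ζ) θ < nu ζ θ := by
  by_contra hcon
  rw [not_lt] at hcon
  -- `ν(a) - a ν'(a)` is positive at `0`; were it nonpositive at `θ`, it would vanish in `(0, θ]`,
  -- against the definition of the critical value.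
  have hcont : ContinuousOn (fun a => nu ζ a - a * deriv (nu ζ) a) (Set.Icc 0 θ) := fun a ha =>
    ((hA.analyticAt_nu ha.1).continuousAt.sub
      (continuousAt_id.mul (hA.analyticAt_nu ha.1).deriv.continuousAt)).continuousWithinAt
  obtain ⟨a, ha, ha0⟩ := intermediate_value_Icc' hθ.le hcont
    (show (0 : ℝ) ∈ Set.Icc _ _ from
      ⟨by simpa using hcon, by simpa using hA.nu_zero_pos.le⟩)
  have hpos : 0 < a := by
    refine lt_of_le_of_ne ha.1 fun h => ?_
    rw [← h] at ha0
    simp only [zero_mul, sub_zero] at ha0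
    exact hA.nu_zero_pos.ne' ha0
  have h1 : thetaCrit ζ ≤ (a : EReal) := by
    refine sInf_le ⟨a, ⟨hpos, ?_⟩, rfl⟩
    rw [div_eq_iff hpos.ne']
    linarith
  have h2 : (a : EReal) ≤ (θ : EReal) := EReal.coe_le_coe_iff.2 ha.2
  exact absurd (hcrit.trans_le (h1.trans h2)) (lt_irrefl _)

/-- The two sides agree at `δ = 0`, where their difference has derivative `θ ν'(θ) - ν(θ) < 0`. This
is what makes the contraction factor less than `1`. -/
theorem Assumptions.eventually_nu_lt [IsProbabilityMeasure ζ] (hA : Assumptions ζ) {θ : ℝ}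
    (hθ : 0 < θ) (hcrit : (θ : EReal) < thetaCrit ζ) :
    ∀ᶠ δ in 𝓝[>] (0 : ℝ), nu ζ ((1 + δ) * θ) < (1 + δ) * nu ζ θ := by
  have h1 : HasDerivAt (fun δ : ℝ => (1 + δ) * θ) (1 * θ) 0 :=
    ((hasDerivAt_id (0 : ℝ)).const_add 1).mul_const θ
  have h2 : HasDerivAt (fun δ : ℝ => nu ζ ((1 + δ) * θ)) (deriv (nu ζ) θ * (1 * θ)) 0 := by
    have h3 := (hA.analyticAt_nu hθ.le).differentiableAt.hasDerivAt
    have h4 : (1 + 0) * θ = θ := by ring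
    exact HasDerivAt.comp (h₂ := nu ζ) 0 (by rw [h4]; exact h3) h1
  have h3 : HasDerivAt (fun δ : ℝ => (1 + δ) * nu ζ θ) (1 * nu ζ θ) 0 :=
    ((hasDerivAt_id (0 : ℝ)).const_add 1).mul_const _
  have h4 := ((h2.sub h3).tendsto_slope_zero.mono_left
    (nhdsWithin_mono 0 fun x (hx : 0 < x) => hx.ne')).eventually
    (Iio_mem_nhds (show deriv (nu ζ) θ * (1 * θ) - 1 * nu ζ θ < 0 by
      have := hA.mul_deriv_nu_lt hθ hcrit
      linarith))
  filter_upwards [h4, self_mem_nhdsWithin] with δ hδ hδ0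
  have hδ0 : 0 < δ := hδ0
  simp only [Pi.sub_apply, zero_add, add_zero, one_mul, sub_self, sub_zero, smul_eq_mul] at hδ
  have h5 : nu ζ ((1 + δ) * θ) - (1 + δ) * nu ζ θ < 0 := by
    by_contra hcon
    exact absurd hδ (not_lt.2 (mul_nonneg (inv_nonneg.2 hδ0.le) (not_lt.1 hcon)))
  linarith

/-- Cauchy–Schwarz bounds the squared sum by `n ∑ y_j²`. After raising to the power `(1 + δ) / 2`,
the weighted mean inequality with weights `(1 - δ) / 2` and `(1 + δ) / 2` separates the two factors.
A moment of the total weight thus needs only a moment of `N` and finiteness of `ν` at `2 θ`. -/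
theorem sum_rpow_le (n : ℕ) (y : ℕ → ℝ) (hy : ∀ j, 0 ≤ y j) {δ p : ℝ} (hδ : 0 < δ) (hδ1 : δ < 1)
    (hp : (1 + δ) / (1 - δ) ≤ 1 + p) :
    (∑ j ∈ Finset.range n, y j) ^ (1 + δ)
      ≤ ∑ j ∈ Finset.range n, y j ^ 2 + (n : ℝ) ^ (1 + p) := by
  have hS : 0 ≤ ∑ j ∈ Finset.range n, y j := Finset.sum_nonneg fun j _ => hy j
  have hQ : 0 ≤ ∑ j ∈ Finset.range n, y j ^ 2 := Finset.sum_nonneg fun j _ => sq_nonneg _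
  have hn : (0 : ℝ) ≤ n := Nat.cast_nonneg n
  have h1 := sq_sum_le_card_mul_sum_sq (s := Finset.range n) (f := y)
  rw [Finset.card_range] at h1
  have hd : 0 < 1 - δ := by linarith
  have h2 : (∑ j ∈ Finset.range n, y j) ^ (1 + δ)
      = ((∑ j ∈ Finset.range n, y j) ^ 2) ^ ((1 + δ) / 2) := by
    rw [← Real.rpow_natCast, ← Real.rpow_mul hS]
    congr 1
    push_cast
    ring
  rw [h2]
  refine (Real.rpow_le_rpow (sq_nonneg _) h1 (by linarith)).trans ?_
  rw [Real.mul_rpow hn hQ]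
  have h3 : (n : ℝ) ^ ((1 + δ) / 2) = ((n : ℝ) ^ ((1 + δ) / (1 - δ))) ^ ((1 - δ) / 2) := by
    rw [← Real.rpow_mul hn]
    congr 1
    field_simp
  rw [h3]
  refine (Real.geom_mean_le_arith_mean2_weighted (by linarith) (by linarith)
    (Real.rpow_nonneg hn _) hQ (by ring)).trans ?_
  have h4 : (n : ℝ) ^ ((1 + δ) / (1 - δ)) ≤ (n : ℝ) ^ (1 + p) := by
    rcases Nat.eq_zero_or_pos n with rfl | hpos
    · have h5 : 0 < (1 + δ) / (1 - δ) := by positivity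
      simp [Real.zero_rpow h5.ne', Real.zero_rpow (h5.trans_le hp).ne']
    · exact Real.rpow_le_rpow_of_exponent_le (by exact_mod_cast hpos) hp
  have h5 : 0 ≤ (n : ℝ) ^ ((1 + δ) / (1 - δ)) := Real.rpow_nonneg hn _
  have h6 : (1 - δ) / 2 * (n : ℝ) ^ ((1 + δ) / (1 - δ)) ≤ 1 * (n : ℝ) ^ ((1 + δ) / (1 - δ)) :=
    mul_le_mul_of_nonneg_right (by linarith) h5
  have h7 : (1 + δ) / 2 * ∑ j ∈ Finset.range n, y j ^ 2 ≤ 1 * ∑ j ∈ Finset.range n, y j ^ 2 :=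
    mul_le_mul_of_nonneg_right (by linarith) hQ
  linarith

/-- The normalized weight `x ↦ e^{θ x - ν(θ)}`. -/
noncomputable def tilt (θ : ℝ) (ζ : Measure (Measure ℝ)) (x : ℝ) : ℝ := Real.exp (θ * x - nu ζ θ)

theorem measurable_tilt (θ : ℝ) (ζ : Measure (Measure ℝ)) : Measurable (tilt θ ζ) := by
  unfold tilt; fun_prop

theorem tilt_pos (θ : ℝ) (ζ : Measure (Measure ℝ)) (x : ℝ) : 0 < tilt θ ζ x := Real.exp_pos _

theorem weightSum_tilt_rpow (θ : ℝ) (ζ : Measure (Measure ℝ)) (r : ℝ) (z : ℕ × (ℕ → ℝ)) :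
    weightSum (fun x => tilt θ ζ x ^ r) z
      = Real.exp (-(r * nu ζ θ)) * weightSum (fun x => Real.exp (r * θ * x)) z := by
  simp only [weightSum, Finset.mul_sum, tilt]
  refine Finset.sum_congr rfl fun j _ => ?_
  rw [← Real.exp_mul, ← Real.exp_add]
  congr 1
  ring

/-- The factor is `m = exp(ν((1+δ)θ) - (1+δ) ν(θ))`, and `C` is the moment itself. Stating this for
all small `δ` permits one exponent common to all phases. -/
theorem IsEnumeration.eventually_isWeight (hκ : IsEnumeration κ ζ) (hA : Assumptions ζ) {θ : ℝ}
    (hθ : 0 < θ) (hcrit : (θ : EReal) < thetaCrit ζ) :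
    ∀ᶠ δ in 𝓝[>] (0 : ℝ), ∃ m C : ℝ, 0 ≤ m ∧ m < 1 ∧ IsWeight κ (tilt θ ζ) δ m C := by
  have := hκ.isProbabilityMeasure_law
  have := hκ.isProbabilityMeasure
  obtain ⟨p, hp, hmom⟩ := hA.card_moment
  obtain ⟨ϑ, hϑ, hfin⟩ := hA.nu_finite
  have hpow : ∀ r : ℝ, 0 ≤ r → Integrable (weightSum fun x => tilt θ ζ x ^ r) κ ∧
      ∫ z, weightSum (fun x => tilt θ ζ x ^ r) z ∂κ
        = Real.exp (nu ζ (r * θ) - r * nu ζ θ) := fun r hr => by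
    obtain ⟨h0, h1⟩ := hfin (r * θ) (by nlinarith [mul_nonneg hr hθ.le])
    have h2 : (weightSum fun x => tilt θ ζ x ^ r) = fun z =>
        Real.exp (-(r * nu ζ θ)) * weightSum (fun x => Real.exp (r * θ * x)) z :=
      funext (weightSum_tilt_rpow θ ζ r)
    rw [h2]
    refine ⟨(hκ.integrable_expSum h1).const_mul _, ?_⟩
    rw [integral_const_mul, hκ.integral_expSum h0 h1, ← Real.exp_add]
    congr 1
    ring
  have hNp : Integrable (fun z : ℕ × (ℕ → ℝ) => (z.1 : ℝ) ^ (1 + p)) κ := by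
    have hmeas : Measurable fun z : ℕ × (ℕ → ℝ) => (z.1 : ℝ) ^ (1 + p) :=
      (measurable_from_top (f := fun n : ℕ => (n : ℝ) ^ (1 + p))).comp measurable_fst
    refine ⟨hmeas.aestronglyMeasurable, ?_⟩
    rw [hasFiniteIntegral_iff_ofReal
      (ae_of_all _ fun z => Real.rpow_nonneg (Nat.cast_nonneg _) _)]
    rw [← hκ.map_eq, lintegral_map (measurable_apply_univ.pow_const _)
      measurable_pointMeasure] at hmom
    refine lt_of_eq_of_lt (lintegral_congr fun z => ?_) hmom
    rw [pointMeasure_univ, ← ENNReal.ofReal_rpow_of_nonneg (Nat.cast_nonneg _) (by linarith),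
      ENNReal.ofReal_natCast]
  have hexp : ∀ᶠ δ in 𝓝[>] (0 : ℝ), (1 + δ) / (1 - δ) < 1 + p := by
    have hc : ContinuousAt (fun δ : ℝ => (1 + δ) / (1 - δ)) 0 :=
      (continuousAt_const.add continuousAt_id).div (continuousAt_const.sub continuousAt_id)
        (by simp)
    have h := hc.tendsto.mono_left (nhdsWithin_le_nhds (s := Set.Ioi 0))
    exact h.eventually (Iio_mem_nhds (by simpa using hp))
  filter_upwards [hA.eventually_nu_lt hθ hcrit, hexp, self_mem_nhdsWithin,
    nhdsWithin_le_nhds (Iio_mem_nhds (zero_lt_one (α := ℝ)))] with δ hδν hδp hδ0 hδ1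
  have hδ0 : 0 < δ := hδ0
  have hδ1 : δ < 1 := hδ1
  have h1 := hpow 1 zero_le_one
  simp only [Real.rpow_one, one_mul, sub_self, Real.exp_zero] at h1
  have h2 := hpow 2 zero_le_two
  have h3 := hpow (1 + δ) (by linarith)
  refine ⟨_, _, (Real.exp_pos _).le, ?_, hκ.isProbabilityMeasure, measurable_tilt θ ζ,
    tilt_pos θ ζ, h1.1, h1.2, h3.1, h3.2.le, ?_, le_rfl⟩
  · rw [Real.exp_lt_one_iff]
    linarith
  · refine (h2.1.add hNp).mono' ?_ (ae_of_all _ fun z => ?_)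
    · exact ((measurable_weightSum (measurable_tilt θ ζ)).pow_const _).aestronglyMeasurable
    · rw [Real.norm_of_nonneg (Real.rpow_nonneg (weightSum_nonneg (tilt_pos θ ζ) z) _)]
      have h := sum_rpow_le z.1 (fun j => tilt θ ζ (z.2 j)) (fun j => (tilt_pos θ ζ _).le)
        hδ0 hδ1 hδp.le
      simpa [weightSum] using h

end TIBRW

namespace TIBRW

/-! ### Conditioning on independent families -/

theorem indepFun_comp_of_disjoint {Ω ι β γ γ' : Type*} [MeasurableSpace Ω] [MeasurableSpace β]
    [MeasurableSpace γ] [MeasurableSpace γ'] {P : Measure Ω} {Y : ι → Ω → β}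
    (hY : ∀ i, Measurable (Y i)) (hind : iIndepFun Y P) {S T : Set ι} (hST : Disjoint S T)
    {g : (S → β) → γ} (hg : Measurable g) {g' : (T → β) → γ'} (hg' : Measurable g') :
    IndepFun (fun ω => g fun i => Y i ω) (fun ω => g' fun i => Y i ω) P := by
  have h := indep_iSup_of_disjoint (fun i => (hY i).comap_le) hind hST
  have hm : ∀ R : Set ι, Measurable[⨆ i ∈ R, MeasurableSpace.comap (Y i) inferInstance]
      fun (ω : Ω) (i : R) => Y i ω := fun R => by
    refine @measurable_pi_lambda _ _ _ (_) _ _ fun i => ?_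
    exact (comap_measurable (Y i)).mono
      (le_iSup₂ (f := fun j (_ : j ∈ R) => MeasurableSpace.comap (Y j) inferInstance) i.1 i.2) le_rfl
  rw [IndepFun_iff_Indep]
  exact indep_of_indep_of_le_left (indep_of_indep_of_le_right h
    (hg'.comp (hm T)).comap_le) (hg.comp (hm S)).comap_le

/-- By independence `X` can be frozen; the index set is then deterministic and the mean of the
product factorizes. -/
theorem integral_prod_finset_of_indep {Ω ι 𝓧 𝓨 : Type*} [Countable ι] [MeasurableSpace Ω]
    [MeasurableSpace 𝓧] [MeasurableSpace 𝓨] {P : Measure Ω} [IsProbabilityMeasure P]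
    {X : Ω → 𝓧} (hX : Measurable X) {Y : ι → Ω → 𝓨} (hY : ∀ i, Measurable (Y i))
    (hYind : iIndepFun Y P) (hXY : IndepFun X (fun ω i => Y i ω) P) {S : 𝓧 → Finset ι}
    (hS : ∀ i, MeasurableSet {x | i ∈ S x}) {h : ι → 𝓧 → 𝓨 → ℂ}
    (hh : ∀ i, Measurable (Function.uncurry (h i))) (hh1 : ∀ i x y, ‖h i x y‖ ≤ 1) :
    ∫ ω, ∏ i ∈ S (X ω), h i (X ω) (Y i ω) ∂P
      = ∫ ω, ∏ i ∈ S (X ω), (∫ ω', h i (X ω) (Y i ω') ∂P) ∂P := by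
  classical
  -- `Finset ι` is countable, so with the discrete σ-algebra measurability can be checked for each
  -- value of the random index set.
  let _ : MeasurableSpace (Finset ι) := ⊤
  have hSm : Measurable S := by
    refine measurable_to_countable' fun s => ?_
    have hset : S ⁻¹' {s} = ⋂ i, {x | i ∈ S x ↔ i ∈ s} := by
      ext x
      simp [Finset.ext_iff]
    rw [hset]
    refine MeasurableSet.iInter fun i => ?_
    by_cases hi : i ∈ s
    · simpa [hi] using hS i
    · have h1 : {x | i ∈ S x ↔ i ∈ s} = {x | i ∈ S x}ᶜ := by
        ext x
        simp [hi]
      rw [h1]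
      exact (hS i).compl
  have hYm : Measurable fun ω i => Y i ω := measurable_pi_lambda _ hY
  have hFm : Measurable fun p : 𝓧 × (ι → 𝓨) => ∏ i ∈ S p.1, h i p.1 (p.2 i) :=
    measurable_of_measurable_slices (N := fun p : 𝓧 × (ι → 𝓨) => S p.1)
      (F := fun s p => ∏ i ∈ s, h i p.1 (p.2 i)) (hSm.comp measurable_fst)
      fun _ => Finset.measurable_prod _ fun i _ =>
        (hh i).comp (measurable_fst.prodMk ((measurable_pi_apply i).comp measurable_snd))
  have hF1 : ∀ p : 𝓧 × (ι → 𝓨), ‖∏ i ∈ S p.1, h i p.1 (p.2 i)‖ ≤ 1 := fun p => by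
    rw [norm_prod]
    exact Finset.prod_le_one (fun _ _ => norm_nonneg _) fun i _ => hh1 i _ _
  have : IsProbabilityMeasure (P.map X) := Measure.isProbabilityMeasure_map hX.aemeasurable
  have : IsProbabilityMeasure (P.map fun ω i => Y i ω) :=
    Measure.isProbabilityMeasure_map hYm.aemeasurable
  have hlaw : P.map (fun ω => (X ω, fun i => Y i ω)) = (P.map X).prod (P.map fun ω i => Y i ω) :=
    hXY.map_prod_eq_prod_map_map hX.aemeasurable hYm.aemeasurable
  have h1 : ∫ ω, ∏ i ∈ S (X ω), h i (X ω) (Y i ω) ∂P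
      = ∫ x, ∫ y, ∏ i ∈ S x, h i x (y i) ∂(P.map fun ω i => Y i ω) ∂(P.map X) := by
    have h2 := integral_map (μ := P) (φ := fun ω => (X ω, fun i => Y i ω))
      (hX.prodMk hYm).aemeasurable hFm.aestronglyMeasurable
    rw [← h2, hlaw, integral_prod _ (Integrable.of_bound hFm.aestronglyMeasurable 1
      (ae_of_all _ hF1))]
  have hinner : ∀ x, ∫ y, ∏ i ∈ S x, h i x (y i) ∂(P.map fun ω i => Y i ω)
      = ∏ i ∈ S x, ∫ ω', h i x (Y i ω') ∂P := fun x => by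
    refine (integral_map hYm.aemeasurable
      (hFm.comp (measurable_prodMk_left (x := x))).aestronglyMeasurable).trans ?_
    have hsub : iIndepFun (fun (i : S x) (ω : Ω) => Y i ω) P :=
      hYind.precomp Subtype.val_injective
    have h3 := hsub.integral_fun_prod_comp (f := fun (i : S x) y => h i x y)
      (fun i => (hY i).aemeasurable)
      fun i => ((hh i).comp (measurable_prodMk_left (x := x))).aestronglyMeasurable
    simp only [Finset.prod_coe_sort (S x) fun i => ∫ ω', h i x (Y i ω') ∂P] at h3
    refine Eq.trans ?_ h3
    refine integral_congr_ae (ae_of_all _ fun ω => ?_)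
    exact (Finset.prod_coe_sort (S x) fun i => h i x (Y i ω)).symm
  rw [h1]
  simp only [hinner]
  have hGm : Measurable fun x => ∏ i ∈ S x, ∫ ω', h i x (Y i ω') ∂P :=
    measurable_of_measurable_slices (F := fun s x => ∏ i ∈ s, ∫ ω', h i x (Y i ω') ∂P) hSm
      fun _ => Finset.measurable_prod _ fun i _ => by
        have hm : StronglyMeasurable (Function.uncurry fun (x : 𝓧) (ω' : Ω) => h i x (Y i ω')) :=
          ((hh i).comp (measurable_fst.prodMk ((hY i).comp measurable_snd))).stronglyMeasurable
        exact (StronglyMeasurable.integral_prod_right (ν := P) hm).measurable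
  rw [integral_map hX.aemeasurable hGm.aestronglyMeasurable]

/-! ### Genealogical trees -/

theorem length_of_mem_particles {N : List ℕ → ℕ} {t : ℕ} {v : List ℕ} (hv : v ∈ particles N t) :
    v.length = t := by
  induction t generalizing v with
  | zero => simp_all [particles]
  | succ t ih =>
    simp only [particles, Finset.mem_biUnion, Finset.mem_image] at hv
    obtain ⟨u, hu, j, -, rfl⟩ := hv
    simp [ih hu]

theorem cons_mem_particles {N : List ℕ → ℕ} {t j : ℕ} {v : List ℕ} :
    j :: v ∈ particles N (t + 1) ↔ v ∈ particles N t ∧ j < N v := by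
  simp [particles]

theorem prod_particles_succ (N : List ℕ → ℕ) (t : ℕ) (g : List ℕ → ℂ) :
    ∏ v ∈ particles N (t + 1), g v
      = ∏ v ∈ particles N t, ∏ j ∈ Finset.range (N v), g (j :: v) := by
  rw [particles, Finset.prod_biUnion]
  · refine Finset.prod_congr rfl fun v _ => Finset.prod_image fun i _ j _ h => ?_
    exact (List.cons.inj h).1
  · intro v _ w _ hvw
    rw [Function.onFun, Finset.disjoint_left]
    rintro _ h1 h2
    obtain ⟨i, -, rfl⟩ := Finset.mem_image.1 h1
    obtain ⟨j, -, h⟩ := Finset.mem_image.1 h2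
    exact hvw (List.cons.inj h).2.symm

theorem particles_congr {N N' : List ℕ → ℕ} {t : ℕ} (h : ∀ v : List ℕ, v.length < t → N v = N' v) :
    particles N t = particles N' t := by
  induction t with
  | zero => rfl
  | succ t ih =>
    have h1 := ih fun v hv => h v (by omega)
    rw [particles, particles, ← h1]
    refine Finset.biUnion_congr rfl fun v hv => ?_
    rw [h v (by rw [length_of_mem_particles hv]; omega)]

theorem position_congr {ξ ξ' : List ℕ → ℕ → ℝ} {v : List ℕ}
    (h : ∀ w : List ℕ, w.length < v.length → ξ w = ξ' w) : position ξ v = position ξ' v := by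
  induction v with
  | nil => rfl
  | cons j v ih =>
    rw [position, position, ih fun w hw => h w (by simp; omega), h v (by simp)]

theorem measurableSet_mem_particles {Ω : Type*} [MeasurableSpace Ω] {N : List ℕ → Ω → ℕ}
    (hN : ∀ v, Measurable (N v)) (t : ℕ) (v : List ℕ) :
    MeasurableSet {ω | v ∈ particles (fun w => N w ω) t} := by
  induction t generalizing v with
  | zero => exact MeasurableSet.const _
  | succ t ih =>
    cases v with
    | nil =>
      have h : {ω | ([] : List ℕ) ∈ particles (fun w => N w ω) (t + 1)} = ∅ := by
        ext ω
        simp [particles]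
      rw [h]
      exact MeasurableSet.empty
    | cons j v =>
      simp only [cons_mem_particles]
      exact (ih v).inter (hN v measurableSet_Ioi)

theorem measurable_position {Ω : Type*} [MeasurableSpace Ω] {ξ : List ℕ → ℕ → Ω → ℝ}
    (hξ : ∀ v j, Measurable (ξ v j)) (v : List ℕ) :
    Measurable fun ω => position (fun w j => ξ w j ω) v := by
  induction v with
  | nil => exact measurable_const
  | cons j v ih => exact ih.add (hξ v j)

/-- `∏_{|v| = t} f(s e^{θ S(v)})`. -/
noncomputable def treeProd (θ : ℝ) (N : List ℕ → ℕ) (ξ : List ℕ → ℕ → ℝ) (t : ℕ) (f : ℝ → ℂ)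
    (s : ℝ) : ℂ :=
  ∏ v ∈ particles N t, f (s * Real.exp (θ * position ξ v))

/-! ### Integrating out generations and exponential variables -/

section Branching

variable {Ω : Type*} [MeasurableSpace Ω] {P : Measure Ω} [IsProbabilityMeasure P]
  {N : List ℕ → Ω → ℕ} {ξ : List ℕ → ℕ → Ω → ℝ}

/-- Conditioning on the first `t` generations. -/
theorem integral_treeProd_succ (hN : ∀ v, Measurable (N v)) (hξ : ∀ v j, Measurable (ξ v j))
    (hind : iIndepFun (fun (v : List ℕ) (ω : Ω) => (N v ω, fun j : ℕ => ξ v j ω)) P) {θ : ℝ}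
    {t : ℕ} {ζ : Measure (Measure ℝ)} {κ : Measure (ℕ × (ℕ → ℝ))} (hκ : IsEnumeration κ ζ)
    (hlaw : ∀ v : List ℕ, v.length = t →
      HasLaw (fun ω => pointMeasure (N v ω) fun j => ξ v j ω) ζ P)
    {f : ℝ → ℂ} (hf : UnitBdd f) {s : ℝ} (hs : 0 ≤ s) :
    ∫ ω, treeProd θ (fun v => N v ω) (fun v j => ξ v j ω) (t + 1) f s ∂P
      = ∫ ω, treeProd θ (fun v => N v ω) (fun v j => ξ v j ω) t
          (branchOp κ (tilt θ ζ) f) (s * Real.exp (nu ζ θ)) ∂P := by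
  classical
  set Y : List ℕ → Ω → ℕ × (ℕ → ℝ) := fun v ω => (N v ω, fun j => ξ v j ω) with hYdef
  have hY : ∀ v, Measurable (Y v) := fun v =>
    (hN v).prodMk (measurable_pi_lambda _ fun j => hξ v j)
  -- Data outside the relevant generations are replaced by `(0, 0)`. These defaults are never read:
  -- generation `t` and its positions depend only on words shorter than `t`.
  set past : ({v : List ℕ | v.length < t} → ℕ × (ℕ → ℝ)) → List ℕ → ℕ × (ℕ → ℝ) :=
    fun d v => if h : v.length < t then d ⟨v, h⟩ else (0, 0) with hpast
  set pres : ({v : List ℕ | v.length = t} → ℕ × (ℕ → ℝ)) → List ℕ → ℕ × (ℕ → ℝ) :=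
    fun d v => if h : v.length = t then d ⟨v, h⟩ else (0, 0) with hpres
  have hpastm : Measurable past := measurable_pi_lambda _ fun v => by
    by_cases h : v.length < t
    · simp only [hpast, h, dite_true]
      exact measurable_pi_apply _
    · simp [hpast, h]
  have hpresm : Measurable pres := measurable_pi_lambda _ fun v => by
    by_cases h : v.length = t
    · simp only [hpres, h, dite_true]
      exact measurable_pi_apply _
    · simp [hpres, h]
  have hdisj : Disjoint {v : List ℕ | v.length < t} {v : List ℕ | v.length = t} :=
    Set.disjoint_left.2 fun v (h1 : v.length < t) (h2 : v.length = t) => by omega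
  have hindep := indepFun_comp_of_disjoint hY hind hdisj hpastm hpresm
  set X : Ω → List ℕ → ℕ × (ℕ → ℝ) := fun ω => past fun v => Y v ω with hXdef
  set Z : List ℕ → Ω → ℕ × (ℕ → ℝ) := fun v ω => if v.length = t then Y v ω else (0, 0) with hZdef
  have hXm : Measurable X :=
    hpastm.comp (measurable_pi_lambda _ fun v => hY v)
  have hZeq : (fun ω => pres fun v => Y v ω) = fun ω v => Z v ω := by
    funext ω v
    by_cases h : v.length = t <;> simp [hpres, hZdef, h]
  rw [hZeq] at hindep
  have hZm : ∀ v, Measurable (Z v) := fun v => by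
    by_cases h : v.length = t
    · simpa [hZdef, h] using hY v
    · simp [hZdef, h]
  have hZind : iIndepFun Z P := by
    have h := hind.comp (fun v z => if v.length = t then z else ((0, 0) : ℕ × (ℕ → ℝ)))
      fun v => by
        by_cases h : v.length = t
        · simpa [h] using measurable_id'
        · simp [h]
    exact h
  have hXN : ∀ ω, particles (fun v => (X ω v).1) t = particles (fun v => N v ω) t := fun ω =>
    particles_congr fun v hv => by simp [hXdef, hpast, hv, hYdef]
  have hXξ : ∀ ω, ∀ v : List ℕ, v.length = t →
      position (fun v j => (X ω v).2 j) v = position (fun v j => ξ v j ω) v := fun ω v hv =>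
    position_congr fun w hw => by
      rw [hv] at hw
      simp [hXdef, hpast, hw, hYdef]
  -- The factor `e^{ν(θ)}` undoes the normalization in `tilt`, so that the argument of `f` is `s`
  -- times the exponential of `θ` times the child's position.
  set h : List ℕ → (List ℕ → ℕ × (ℕ → ℝ)) → ℕ × (ℕ → ℝ) → ℂ := fun v x z =>
    ∏ j ∈ Finset.range z.1,
      f (s * Real.exp (nu ζ θ) * Real.exp (θ * position (fun v j => (x v).2 j) v)
        * tilt θ ζ (z.2 j)) with hh
  have hcoef : ∀ r : ℝ, 0 ≤ s * Real.exp (nu ζ θ) * Real.exp r := fun r => by positivity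
  have hposm : ∀ v, Measurable fun x : List ℕ → ℕ × (ℕ → ℝ) =>
      position (fun v j => (x v).2 j) v := fun v =>
    measurable_position (ξ := fun v j (x : List ℕ → ℕ × (ℕ → ℝ)) => (x v).2 j) (fun v j =>
      (measurable_pi_apply j).comp (measurable_snd.comp (measurable_pi_apply v))) v
  have hhm : ∀ v, Measurable (Function.uncurry (h v)) := fun v =>
    (measurable_branch_integrand (measurable_tilt θ ζ) hf.measurable).comp
      ((((hposm v).const_mul θ).exp.const_mul (s * Real.exp (nu ζ θ))).comp
        measurable_fst |>.prodMk measurable_snd)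
  have hh1 : ∀ v x z, ‖h v x z‖ ≤ 1 := fun v x z =>
    norm_branch_integrand_le (tilt_pos θ ζ) hf (hcoef _) z
  have hmem : ∀ v, MeasurableSet {x : List ℕ → ℕ × (ℕ → ℝ) |
      v ∈ particles (fun v => (x v).1) t} := fun v =>
    measurableSet_mem_particles (N := fun v (x : List ℕ → ℕ × (ℕ → ℝ)) => (x v).1)
      (fun v => measurable_fst.comp (measurable_pi_apply v)) t v
  have key := integral_prod_finset_of_indep hXm hZm hZind hindep hmem hhm hh1
  have hleft : ∀ ω, treeProd θ (fun v => N v ω) (fun v j => ξ v j ω) (t + 1) f s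
      = ∏ v ∈ particles (fun v => (X ω v).1) t, h v (X ω) (Z v ω) := fun ω => by
    rw [treeProd, prod_particles_succ, hXN]
    refine Finset.prod_congr rfl fun v hv => ?_
    have hl := length_of_mem_particles hv
    have hZv : Z v ω = Y v ω := by simp [hZdef, hl]
    simp only [hh, hZv, hXξ ω v hl]
    refine Finset.prod_congr rfl fun j _ => ?_
    congr 1
    simp only [position, tilt, hYdef]
    rw [mul_assoc, mul_assoc, ← Real.exp_add, ← Real.exp_add]
    congr 2
    ring
  have hright : ∀ ω, treeProd θ (fun v => N v ω) (fun v j => ξ v j ω) t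
      (branchOp κ (tilt θ ζ) f) (s * Real.exp (nu ζ θ))
      = ∏ v ∈ particles (fun v => (X ω v).1) t, ∫ ω', h v (X ω) (Z v ω') ∂P := fun ω => by
    rw [treeProd, hXN]
    refine Finset.prod_congr rfl fun v hv => ?_
    have hl := length_of_mem_particles hv
    have hZv : Z v = Y v := by funext ω'; simp [hZdef, hl]
    simp only [hh, hZv, hXξ ω v hl]
    have hκ' : IsEnumeration (P.map (Y v)) ζ :=
      ⟨Measure.isProbabilityMeasure_map (hY v).aemeasurable, by
        rw [Measure.map_map measurable_pointMeasure (hY v)]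
        exact (hlaw v hl).map_eq⟩
    rw [hκ.branchOp_eq hκ' (measurable_tilt θ ζ) (tilt_pos θ ζ) hf (hcoef _), branchOp]
    exact integral_map (hY v).aemeasurable ((measurable_branch_integrand (measurable_tilt θ ζ)
      hf.measurable).comp measurable_prodMk_left).aestronglyMeasurable
  simp only [hleft, hright]
  exact key

/-- The last generation is removed first, so its transform acts first on `f`; each removal
contributes a factor `e^{ν(θ)}`. -/
theorem integral_treeProd_add (hN : ∀ v, Measurable (N v)) (hξ : ∀ v j, Measurable (ξ v j))
    (hind : iIndepFun (fun (v : List ℕ) (ω : Ω) => (N v ω, fun j : ℕ => ξ v j ω)) P) {θ : ℝ}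
    {t r : ℕ} {ζ : Measure (Measure ℝ)} {κ : Measure (ℕ × (ℕ → ℝ))} (hκ : IsEnumeration κ ζ)
    (hlaw : ∀ v : List ℕ, t ≤ v.length → v.length < t + r →
      HasLaw (fun ω => pointMeasure (N v ω) fun j => ξ v j ω) ζ P)
    {f : ℝ → ℂ} (hf : UnitBdd f) {s : ℝ} (hs : 0 ≤ s) :
    ∫ ω, treeProd θ (fun v => N v ω) (fun v j => ξ v j ω) (t + r) f s ∂P
      = ∫ ω, treeProd θ (fun v => N v ω) (fun v j => ξ v j ω) t
          ((branchOp κ (tilt θ ζ))^[r] f) (s * Real.exp (r * nu ζ θ)) ∂P := by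
  have := hκ.isProbabilityMeasure
  induction r generalizing f s with
  | zero => simp
  | succ r ih =>
    rw [← add_assoc, integral_treeProd_succ hN hξ hind hκ
      (fun v hv => hlaw v (by omega) (by omega)) hf hs,
      ih (fun v h1 h2 => hlaw v h1 (by omega))
        (hf.branchOp (measurable_tilt θ ζ) (tilt_pos θ ζ)) (by positivity),
      Function.iterate_succ_apply, mul_assoc, ← Real.exp_add]
    congr! 5
    push_cast
    ring

/-- Conditioning on the branching random walk. -/
theorem integral_prod_indicator_eq_treeProd (hN : ∀ v, Measurable (N v))
    (hξ : ∀ v j, Measurable (ξ v j)) {E : List ℕ → Ω → ℝ} (hE : ∀ v, Measurable (E v)) {n : ℕ}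
    (hlaw : ∀ v : List ℕ, v.length = n → HasLaw (E v) (expMeasure 1) P) (hind : iIndepFun E P)
    (hindE : IndepFun (fun (ω : Ω) (v : List ℕ) => (N v ω, fun j : ℕ => ξ v j ω))
      (fun (ω : Ω) (v : List ℕ) => E v ω) P) {θ : ℝ}
    (hint : ∀ a : ℝ, ∫ e, (if 1 / θ * (-Real.log e) ≤ a then 1 else 0 : ℂ) ∂(expMeasure 1)
      = expFun (-1) (Real.exp (-(θ * a)))) (x : ℝ) :
    ∫ ω, ∏ v ∈ particles (fun v => N v ω) n,
        (if position (fun v j => ξ v j ω) v + 1 / θ * (-Real.log (E v ω)) ≤ x then 1 else 0 : ℂ) ∂P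
      = ∫ ω, treeProd θ (fun v => N v ω) (fun v j => ξ v j ω) n (expFun (-1))
          (Real.exp (-(θ * x))) ∂P := by
  set X : Ω → List ℕ → ℕ × (ℕ → ℝ) := fun ω v => (N v ω, fun j => ξ v j ω) with hX
  have hXm : Measurable X := measurable_pi_lambda _ fun v =>
    (hN v).prodMk (measurable_pi_lambda _ fun j => hξ v j)
  set h : List ℕ → (List ℕ → ℕ × (ℕ → ℝ)) → ℝ → ℂ := fun v y e =>
    if position (fun v j => (y v).2 j) v + 1 / θ * (-Real.log e) ≤ x then 1 else 0 with hh
  have hposm : ∀ v, Measurable fun x : List ℕ → ℕ × (ℕ → ℝ) =>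
      position (fun v j => (x v).2 j) v := fun v =>
    measurable_position (ξ := fun v j (x : List ℕ → ℕ × (ℕ → ℝ)) => (x v).2 j) (fun v j =>
      (measurable_pi_apply j).comp (measurable_snd.comp (measurable_pi_apply v))) v
  have hhm : ∀ v, Measurable (Function.uncurry (h v)) := fun v => by
    refine Measurable.ite (measurableSet_le ?_ measurable_const) measurable_const measurable_const
    exact ((hposm v).comp measurable_fst).add
      ((Real.measurable_log.comp measurable_snd).neg.const_mul _)
  have hh1 : ∀ v y e, ‖h v y e‖ ≤ 1 := fun v y e => by
    simp only [hh]
    split_ifs <;> simp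
  have hmem : ∀ v, MeasurableSet {x : List ℕ → ℕ × (ℕ → ℝ) |
      v ∈ particles (fun v => (x v).1) n} := fun v =>
    measurableSet_mem_particles (N := fun v (x : List ℕ → ℕ × (ℕ → ℝ)) => (x v).1)
      (fun v => measurable_fst.comp (measurable_pi_apply v)) n v
  have key := integral_prod_finset_of_indep hXm hE hind hindE hmem hhm hh1
  refine key.trans (integral_congr_ae (ae_of_all _ fun ω => ?_))
  refine Finset.prod_congr rfl fun v hv => ?_
  have hl := length_of_mem_particles hv
  have h1 : ∫ ω', h v (X ω) (E v ω') ∂P = ∫ e, h v (X ω) e ∂(expMeasure 1) := by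
    rw [← (hlaw v hl).map_eq]
    exact (integral_map (hE v).aemeasurable
      ((hhm v).comp measurable_prodMk_left).aestronglyMeasurable).symm
  rw [h1]
  have h2 := hint (x - position (fun v j => ξ v j ω) v)
  simp only [le_sub_iff_add_le'] at h2
  refine h2.trans ?_
  rw [← Real.exp_add]
  congr 2
  ring

end Branching

end TIBRW

namespace TIBRW

/-! ### The rightmost position -/

theorem expMeasure_one_real_Ici {y : ℝ} (hy : 0 ≤ y) :
    (expMeasure 1).real (Set.Ici y) = Real.exp (-y) := by
  have hac : expMeasure 1 ≪ volume := withDensity_absolutelyContinuous _ _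
  have h1 : (expMeasure 1).real (Set.Iic y) = 1 - Real.exp (-y) := by
    rw [← cdf_eq_real, cdf_expMeasure_eq one_pos, if_pos hy, one_mul]
  have h2 : (expMeasure 1).real (Set.Iio y) = (expMeasure 1).real (Set.Iic y) :=
    measureReal_congr (hac.ae_eq Iio_ae_eq_Iic)
  have h3 : Set.Ici y = (Set.Iio y)ᶜ := Set.compl_Iio.symm
  rw [h3, probReal_compl_eq_one_sub measurableSet_Iio, h2, h1]
  ring

theorem ae_pos_expMeasure : ∀ᵐ e ∂(expMeasure 1), 0 < e := by
  have hac : expMeasure 1 ≪ volume := withDensity_absolutelyContinuous _ _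
  have h1 : (expMeasure 1).real (Set.Ioi 0) = 1 := by
    rw [measureReal_congr (hac.ae_eq Ioi_ae_eq_Ici), expMeasure_one_real_Ici le_rfl]
    simp
  have h2 : expMeasure 1 (Set.Ioi 0) = 1 := by
    rw [measureReal_def] at h1
    exact (ENNReal.toReal_eq_one_iff _).1 h1
  exact (prob_compl_eq_zero_iff measurableSet_Ioi).2 h2

theorem integral_ite_eq_real {Ω : Type*} [MeasurableSpace Ω] {P : Measure Ω} {p : Ω → Prop}
    [DecidablePred p] (hp : MeasurableSet {ω | p ω}) :
    ∫ ω, (if p ω then 1 else 0 : ℂ) ∂P = P.real {ω | p ω} := by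
  have h : (fun ω => (if p ω then 1 else 0 : ℂ))
      = fun ω => ((({ω | p ω} : Set Ω).indicator 1 ω : ℝ) : ℂ) := by
    funext ω
    by_cases hω : p ω <;> simp [hω]
  rw [h, integral_complex_ofReal, integral_indicator_one hp]

theorem integral_ite_log_expMeasure {θ : ℝ} (hθ : 0 < θ) (a : ℝ) :
    ∫ e, (if 1 / θ * (-Real.log e) ≤ a then 1 else 0 : ℂ) ∂(expMeasure 1)
      = expFun (-1) (Real.exp (-(θ * a))) := by
  rw [integral_ite_eq_real (measurableSet_le (by fun_prop) measurable_const)]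
  have h : {e | 1 / θ * (-Real.log e) ≤ a} =ᵐ[expMeasure 1] Set.Ici (Real.exp (-(θ * a))) := by
    filter_upwards [ae_pos_expMeasure] with e he
    refine propext ?_
    change 1 / θ * (-Real.log e) ≤ a ↔ Real.exp (-(θ * a)) ≤ e
    rw [← Real.le_log_iff_exp_le he, one_div, inv_mul_le_iff₀ hθ, neg_le]
  rw [measureReal_congr h, expMeasure_one_real_Ici (Real.exp_pos _).le]
  simp [expFun]

/-- The distribution function of `(log Δ - log E) / θ`. -/
theorem integral_ite_log_sub_log {θ : ℝ} (hθ : 0 < θ) {μ : Measure ℝ} [IsProbabilityMeasure μ]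
    (hμ : ∀ᵐ x ∂μ, 0 < x) (x : ℝ) :
    ∫ w : ℝ × ℝ, (if 1 / θ * (Real.log w.1 - Real.log w.2) ≤ x then 1 else 0 : ℂ)
        ∂(μ.prod (expMeasure 1))
      = expTransform (-1) μ (Real.exp (-(θ * x))) := by
  have hm : Measurable fun w : ℝ × ℝ =>
      (if 1 / θ * (Real.log w.1 - Real.log w.2) ≤ x then 1 else 0 : ℂ) :=
    Measurable.ite (measurableSet_le (by fun_prop) measurable_const) measurable_const
      measurable_const
  rw [integral_prod _ (Integrable.of_bound hm.aestronglyMeasurable 1 (ae_of_all _ fun w => by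
    split_ifs <;> simp))]
  refine integral_congr_ae ?_
  filter_upwards [hμ] with d hd
  have h1 := integral_ite_log_expMeasure hθ (x - 1 / θ * Real.log d)
  have h2 : Real.exp (-(θ * (x - 1 / θ * Real.log d))) = Real.exp (-(θ * x)) * d := by
    have h3 : -(θ * (x - 1 / θ * Real.log d)) = -(θ * x) + Real.log d := by
      field_simp
      ring
    rw [h3, Real.exp_add, Real.exp_log hd]
  rw [h2] at h1
  rw [← h1]
  refine integral_congr_ae (ae_of_all _ fun e => if_congr ?_ rfl rfl)
  rw [le_sub_iff_add_le']
  ring_nf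

/-- The intervals `(a, b]` form a π-system containing arbitrarily small neighbourhoods of each
point, and their masses are differences of distribution functions. Convergence is required at every
`x`, so continuity points play no role. -/
theorem tendsto_of_tendsto_Iic {μ : ℕ → ProbabilityMeasure ℝ} {ν : ProbabilityMeasure ℝ}
    (h : ∀ x, Tendsto (fun n => (μ n : Measure ℝ).real (Set.Iic x)) atTop
      (𝓝 ((ν : Measure ℝ).real (Set.Iic x)))) : Tendsto μ atTop (𝓝 ν) := by
  refine (isPiSystem_Ioc (id : ℝ → ℝ) id).tendsto_probabilityMeasure_of_tendsto_of_mem ?_ ?_ ?_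
  · rintro _ ⟨a, b, -, rfl⟩
    exact measurableSet_Ioc
  · intro u hu x hx
    obtain ⟨ε, hε, hsub⟩ := Metric.isOpen_iff.1 hu x hx
    refine ⟨Set.Ioc (x - ε / 2) (x + ε / 2), ⟨_, _, ?_, rfl⟩,
      Ioc_mem_nhds (by linarith) (by linarith), fun y hy => hsub ?_⟩
    · simp only [id]; linarith
    · rw [Metric.mem_ball, Real.dist_eq, abs_lt]
      constructor <;> linarith [hy.1, hy.2]
  · rintro _ ⟨a, b, hab, rfl⟩
    have hIoc : ∀ ρ : ProbabilityMeasure ℝ, ((ρ (Set.Ioc a b) : NNReal) : ℝ)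
        = (ρ : Measure ℝ).real (Set.Iic b) - (ρ : Measure ℝ).real (Set.Iic a) := fun ρ => by
      have hab' : a < b := hab
      rw [← measureReal_sdiff (Set.Iic_subset_Iic.2 hab'.le) measurableSet_Iic, Set.Iic_sdiff_Iic]
      rfl
    rw [← NNReal.tendsto_coe]
    simp only [id, hIoc]
    exact (h b).sub (h a)

/-- The last clause reflects `sSup ∅ = 0`; it matters for measurability and is dropped later,
generation `n` being almost surely nonempty. -/
theorem rightmost_le_iff {θ : ℝ} {n : ℕ} {N : List ℕ → ℕ} {ξ : List ℕ → ℕ → ℝ} {E : List ℕ → ℝ}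
    {x : ℝ} :
    rightmost θ n N ξ E ≤ x ↔
      (∀ v, v ∈ particles N n → position ξ v + 1 / θ * (-Real.log (E v)) ≤ x) ∧
        ((∃ v, v ∈ particles N n) ∨ 0 ≤ x) := by
  rw [rightmost]
  have hfin : ((fun v => position ξ v + 1 / θ * (-Real.log (E v))) ''
      (particles N n : Set (List ℕ))).Finite := (particles N n).finite_toSet.image _
  rcases (particles N n).eq_empty_or_nonempty with he | hne
  · simp [he, Real.sSup_empty]
  · rw [csSup_le_iff hfin.bddAbove (hne.to_set.image _)]
    have hne' : ∃ v, v ∈ particles N n := hne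
    simp [hne']

theorem measurable_rightmost {Ω : Type*} [MeasurableSpace Ω] {θ : ℝ} {n : ℕ}
    {N : List ℕ → Ω → ℕ} {ξ : List ℕ → ℕ → Ω → ℝ} {E : List ℕ → Ω → ℝ}
    (hN : ∀ v, Measurable (N v)) (hξ : ∀ v j, Measurable (ξ v j)) (hE : ∀ v, Measurable (E v)) :
    Measurable fun ω => rightmost θ n (fun v => N v ω) (fun v j => ξ v j ω) fun v => E v ω := by
  refine measurable_of_Iic fun x => ?_
  have hpos : ∀ v, MeasurableSet
      {ω | position (fun w j => ξ w j ω) v + 1 / θ * (-Real.log (E v ω)) ≤ x} := fun v =>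
    measurableSet_le ((measurable_position hξ v).add
      ((Real.measurable_log.comp (hE v)).neg.const_mul _)) measurable_const
  have hmem := measurableSet_mem_particles hN n
  have h : (fun ω => rightmost θ n (fun v => N v ω) (fun v j => ξ v j ω) fun v => E v ω) ⁻¹'
        Set.Iic x
      = (⋂ v, ({ω | v ∈ particles (fun w => N w ω) n}ᶜ
          ∪ {ω | position (fun w j => ξ w j ω) v + 1 / θ * (-Real.log (E v ω)) ≤ x}))
        ∩ ((⋃ v, {ω | v ∈ particles (fun w => N w ω) n}) ∪ {_ω | 0 ≤ x}) := by
    ext ω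
    simp only [Set.mem_preimage, Set.mem_Iic, rightmost_le_iff, Set.mem_inter_iff, Set.mem_iInter,
      Set.mem_union, Set.mem_compl_iff, Set.mem_iUnion, imp_iff_not_or, Set.mem_ofPred_eq]
  rw [h]
  exact (MeasurableSet.iInter fun v => (hmem v).compl.union (hpos v)).inter
    ((MeasurableSet.iUnion hmem).union (MeasurableSet.const _))

theorem particles_nonempty {N : List ℕ → ℕ} {n : ℕ} (h : ∀ v : List ℕ, v.length < n → 1 ≤ N v) :
    ∃ v, v ∈ particles N n := by
  induction n with
  | zero => exact ⟨[], by simp [particles]⟩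
  | succ n ih =>
    obtain ⟨v, hv⟩ := ih fun v hv => h v (by omega)
    have hl := length_of_mem_particles hv
    exact ⟨0 :: v, cons_mem_particles.2 ⟨hv, h v (by omega)⟩⟩

/-! ### Phases of the time inhomogeneous branching random walk -/

/-- The time `∑_{j < m} q j` at which the phase `m` starts. -/
def phaseStart {k : ℕ} (q : Fin k → ℕ) (m : ℕ) : ℕ := ∑ j with j.val < m, q j

section Phases

variable {k : ℕ} {q : Fin k → ℕ}

theorem sum_Iio_eq_phaseStart (i : Fin k) : ∑ j ∈ Finset.Iio i, q j = phaseStart q i := by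
  rw [phaseStart]
  refine Finset.sum_congr ?_ fun _ _ => rfl
  ext j
  simp only [Finset.mem_Iio, Finset.mem_filter, Finset.mem_univ, true_and]
  exact Fin.lt_def

theorem sum_Iic_eq_phaseStart (i : Fin k) : ∑ j ∈ Finset.Iic i, q j = phaseStart q (i + 1) := by
  rw [phaseStart]
  refine Finset.sum_congr ?_ fun _ _ => rfl
  ext j
  simp only [Finset.mem_Iic, Finset.mem_filter, Finset.mem_univ, true_and]
  exact Fin.le_def.trans Nat.lt_succ_iff.symm

theorem phaseStart_zero : phaseStart q 0 = 0 := by simp [phaseStart]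

theorem phaseStart_top : phaseStart q k = ∑ i, q i := by
  simp [phaseStart]

theorem filter_lt_succ (i : Fin k) : (Finset.univ.filter fun j : Fin k => j.val < i.val + 1)
    = insert i (Finset.univ.filter fun j : Fin k => j.val < i.val) := by
  ext j
  simp [Fin.ext_iff]
  omega

theorem phaseStart_succ (i : Fin k) : phaseStart q (i + 1) = phaseStart q i + q i := by
  rw [phaseStart, filter_lt_succ, Finset.sum_insert (by simp), phaseStart, add_comm]

theorem exists_phase {m t : ℕ} (hm : m ≤ k) (ht : t < phaseStart q m) :
    ∃ i : Fin k, phaseStart q i ≤ t ∧ t < phaseStart q (i + 1) := by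
  induction m with
  | zero => simp [phaseStart_zero] at ht
  | succ m ih =>
    rcases lt_or_ge t (phaseStart q m) with h | h
    · exact ih (by omega) h
    · exact ⟨⟨m, by omega⟩, h, ht⟩

theorem sum_filter_le (g : Fin k → ℝ) (i : Fin k) :
    ∑ j with i.val ≤ j.val, g j = g i + ∑ j with i.val + 1 ≤ j.val, g j := by
  have h : (Finset.univ.filter fun j : Fin k => i.val ≤ j.val)
      = insert i (Finset.univ.filter fun j : Fin k => i.val + 1 ≤ j.val) := by
    ext j
    simp [Fin.ext_iff]
    omega
  rw [h, Finset.sum_insert (by simp)]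

variable {Ω : Type*} [MeasurableSpace Ω] {P : Measure Ω}
  {N : List ℕ → Ω → ℕ} {ξ : List ℕ → ℕ → Ω → ℝ} {E : List ℕ → Ω → ℝ}
  {ζ : Fin k → Measure (Measure ℝ)}

theorem IsLPMTIBRW.hasLaw (h : IsLPMTIBRW ζ q P N ξ E) (i : Fin k) {v : List ℕ}
    (h1 : phaseStart q i ≤ v.length) (h2 : v.length < phaseStart q (i + 1)) :
    HasLaw (fun ω => pointMeasure (N v ω) (fun j => ξ v j ω)) (ζ i) P :=
  h.law_offspring i v (by rw [sum_Iio_eq_phaseStart]; omega) (by rw [sum_Iic_eq_phaseStart]; omega)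

theorem IsLPMTIBRW.ae_nonempty (h : IsLPMTIBRW ζ q P N ξ E) (hζ : ∀ i, IsPointProcessLaw (ζ i))
    (hA : ∀ i, Assumptions (ζ i)) :
    ∀ᵐ ω ∂P, ∃ v, v ∈ particles (fun v => N v ω) (∑ i, q i) := by
  have h1 : ∀ v : List ℕ, ∀ᵐ ω ∂P, v.length < ∑ i, q i → 1 ≤ N v ω := fun v => by
    by_cases hv : v.length < ∑ i, q i
    · rw [← phaseStart_top] at hv
      obtain ⟨i, hi1, hi2⟩ := exists_phase le_rfl hv
      have hlaw := h.hasLaw i hi1 hi2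
      obtain ⟨κ, hκ⟩ := hζ i
      have := hκ.isProbabilityMeasure_law
      have h2 := (hA i).ae_one_le
      rw [← hlaw.map_eq] at h2
      filter_upwards [ae_of_ae_map hlaw.aemeasurable h2] with ω hω _
      rw [pointMeasure_univ] at hω
      exact_mod_cast hω
    · exact ae_of_all _ fun ω hω => absurd hω hv
  filter_upwards [ae_all_iff.2 h1] with ω hω
  exact particles_nonempty hω

/-- The distribution function of the rightmost position. -/
theorem IsLPMTIBRW.real_rightmost_le [IsProbabilityMeasure P] (h : IsLPMTIBRW ζ q P N ξ E)
    (hζ : ∀ i, IsPointProcessLaw (ζ i)) (hA : ∀ i, Assumptions (ζ i)) {θ : ℝ} (hθ : 0 < θ)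
    (x : ℝ) :
    (P.real {ω | rightmost θ (∑ i, q i) (fun v => N v ω) (fun v j => ξ v j ω)
        (fun v => E v ω) ≤ x} : ℂ)
      = ∫ ω, treeProd θ (fun v => N v ω) (fun v j => ξ v j ω) (∑ i, q i) (expFun (-1))
          (Real.exp (-(θ * x))) ∂P := by
  rw [← integral_prod_indicator_eq_treeProd h.measurable_N h.measurable_ξ h.measurable_E h.law_E
    h.indep_E h.indep_offspring_E (integral_ite_log_expMeasure hθ) x]
  classical
  have hm : MeasurableSet {ω | rightmost θ (∑ i, q i) (fun v => N v ω) (fun v j => ξ v j ω)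
      (fun v => E v ω) ≤ x} :=
    measurable_rightmost h.measurable_N h.measurable_ξ h.measurable_E measurableSet_Iic
  rw [← integral_ite_eq_real hm]
  refine integral_congr_ae ?_
  filter_upwards [h.ae_nonempty hζ hA] with ω hω
  rw [Finset.prod_ite_zero, Finset.prod_const_one]
  refine if_congr ?_ rfl rfl
  rw [rightmost_le_iff]
  simp [hω]

/-- The later phases turn `e^{-t}` into a function close to `e^{-t}`, uniformly in their lengths. -/
theorem IsLPMTIBRW.exists_integral_treeProd_eq [IsProbabilityMeasure P]
    (h : IsLPMTIBRW ζ q P N ξ E)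
    {κ : Fin k → Measure (ℕ × (ℕ → ℝ))} (hκ : ∀ i, IsEnumeration (κ i) (ζ i)) {θ δ B : ℝ}
    (hδ : 0 < δ) (hδ1 : δ ≤ 1) (hB : 0 ≤ B) {m C : Fin k → ℝ}
    (hw : ∀ i, IsWeight (κ i) (tilt θ (ζ i)) δ (m i) (C i))
    (hBm : ∀ i, 3 * (C i + 1) + B * m i ≤ B) (r l : ℕ) (hl : l + r = k) :
    ∃ F, UnitBdd F ∧ (∀ t, 0 ≤ t → ‖F t - expFun (-1) t‖ ≤ B * t ^ (1 + δ)) ∧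
      ∀ s, 0 ≤ s → ∫ ω, treeProd θ (fun v => N v ω) (fun v j => ξ v j ω) (∑ i, q i)
          (expFun (-1)) s ∂P
        = ∫ ω, treeProd θ (fun v => N v ω) (fun v j => ξ v j ω) (phaseStart q l) F
          (s * Real.exp (∑ j with l ≤ j.val, q j * nu (ζ j) θ)) ∂P := by
  have hu : (-1 : ℂ).re ≤ 0 := by simp
  have hu1 : ‖(-1 : ℂ)‖ = 1 := by simp
  induction r generalizing l with
  | zero =>
    obtain rfl : l = k := by omega
    refine ⟨expFun (-1), unitBdd_expFun hu, fun t ht => ?_, fun s _ => ?_⟩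
    · rw [sub_self, norm_zero]
      positivity
    · have h1 : (Finset.univ.filter fun j : Fin l => l ≤ j.val) = ∅ := by
        ext j
        simp
      rw [phaseStart_top, h1]
      simp
  | succ r ih =>
    -- Phases are absorbed from the last backwards, and `B` serves for all of them, so the bound
    -- does not deteriorate.
    obtain ⟨F, hF, hFB, hFint⟩ := ih (l + 1) (by omega)
    obtain ⟨i, hi⟩ : ∃ i : Fin k, l = i.val := ⟨⟨l, by omega⟩, rfl⟩
    subst hi
    have := (hκ i).isProbabilityMeasure
    refine ⟨(branchOp (κ i) (tilt θ (ζ i)))^[q i] F,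
      hF.iterate_branchOp (measurable_tilt _ _) (tilt_pos _ _) _, fun t ht =>
      norm_iterate_branchOp_sub_expFun_le (hw i) hδ hδ1 hu hu1 hF hB (hBm i) hFB _ ht,
      fun s hs => ?_⟩
    rw [hFint s hs, phaseStart_succ, integral_treeProd_add h.measurable_N h.measurable_ξ
      h.indep_offspring (hκ i) (fun v h1 h2 => h.hasLaw i h1 (by rw [phaseStart_succ]; exact h2))
      hF (by positivity), mul_assoc, ← Real.exp_add,
      sum_filter_le (fun j => (q j : ℝ) * nu (ζ j) θ) i, add_comm]

end Phases

/-- Once the later phases are inside `F` and the first has been integrated out, only the root at `0`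
remains. The accumulated factor `e^{∑ q_i ν_i(θ)}` cancels exactly against the centring. -/
theorem IsLPMTIBRW.exists_real_rightmost_sub_le_eq {k : ℕ} {q : Fin (k + 1) → ℕ} {Ω : Type*}
    [MeasurableSpace Ω] {P : Measure Ω} [IsProbabilityMeasure P]
    {N : List ℕ → Ω → ℕ} {ξ : List ℕ → ℕ → Ω → ℝ} {E : List ℕ → Ω → ℝ}
    {ζ : Fin (k + 1) → Measure (Measure ℝ)} (h : IsLPMTIBRW ζ q P N ξ E)
    (hA : ∀ i, Assumptions (ζ i)) {κ : Fin (k + 1) → Measure (ℕ × (ℕ → ℝ))}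
    (hκ : ∀ i, IsEnumeration (κ i) (ζ i)) {θ δ B : ℝ} (hθ : 0 < θ)
    (hδ : 0 < δ) (hδ1 : δ ≤ 1) (hB : 0 ≤ B) {m C : Fin (k + 1) → ℝ}
    (hw : ∀ i, IsWeight (κ i) (tilt θ (ζ i)) δ (m i) (C i))
    (hBm : ∀ i, 3 * (C i + 1) + B * m i ≤ B) :
    ∃ F, UnitBdd F ∧ (∀ t, 0 ≤ t → ‖F t - expFun (-1) t‖ ≤ B * t ^ (1 + δ)) ∧
      ∀ x, (P.real {ω | rightmost θ (∑ i, q i) (fun v => N v ω) (fun v j => ξ v j ω)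
          (fun v => E v ω) - ∑ i, (q i : ℝ) * nu (ζ i) θ / θ ≤ x} : ℂ)
        = (branchOp (κ 0) (tilt θ (ζ 0)))^[q 0] F (Real.exp (-(θ * x))) := by
  obtain ⟨F, hF, hFB, hFint⟩ := h.exists_integral_treeProd_eq hκ hδ hδ1 hB hw hBm k 1 (by omega)
  refine ⟨F, hF, hFB, fun x => ?_⟩
  simp only [sub_le_iff_le_add]
  have h0 : phaseStart q 1 = 0 + q 0 := by
    have := phaseStart_succ (q := q) 0
    simpa [phaseStart_zero] using this
  rw [h.real_rightmost_le (fun i => ⟨κ i, hκ i⟩) hA hθ, hFint _ (Real.exp_pos _).le, h0,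
    integral_treeProd_add h.measurable_N h.measurable_ξ h.indep_offspring (hκ 0)
      (fun v h1 h2 => h.hasLaw 0 (by simp [phaseStart_zero])
        (by rw [phaseStart_succ]; simpa [phaseStart_zero] using h2)) hF (by positivity)]
  simp only [treeProd, particles, Finset.prod_singleton, position, mul_zero, Real.exp_zero,
    mul_one, integral_const, probReal_univ, one_smul]
  rw [← Real.exp_add, ← Real.exp_add]
  have h1 := sum_filter_le (fun j => (q j : ℝ) * nu (ζ j) θ) (0 : Fin (k + 1))
  have h2 : ∑ j with (0 : Fin (k + 1)).val ≤ j.val, (q j : ℝ) * nu (ζ j) θ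
      = ∑ j, (q j : ℝ) * nu (ζ j) θ := by simp
  rw [h2] at h1
  rw [← Finset.sum_div, mul_add, mul_div_cancel₀ _ hθ.ne', h1]
  simp only [Fin.val_zero, zero_add]
  refine congrArg _ (congrArg Real.exp ?_)
  ring

/-- The enumeration witnessing the fixed-point equation may differ from `κ`, but `branchOp` depends
only on the law of the point process. -/
theorem IsMeanOneSolution.expTransform_fixed {θ : ℝ} {ζ : Measure (Measure ℝ)}
    {D : ProbabilityMeasure ℝ} (h : IsMeanOneSolution θ ζ D) {κ : Measure (ℕ × (ℕ → ℝ))}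
    (hκ : IsEnumeration κ ζ) {u : ℂ} (hu : ∀ᵐ x ∂(D : Measure ℝ), x * u.re ≤ 0) {t : ℝ}
    (ht : 0 ≤ t) :
    branchOp κ (tilt θ ζ) (expTransform u D) t = expTransform u D t := by
  obtain ⟨κ', hκ', hfix⟩ := h.fixed_point
  have := hκ'.isProbabilityMeasure
  have hfix' : smoothing κ' (tilt θ ζ) (D : Measure ℝ) = D := hfix
  rw [hκ.branchOp_eq hκ' (measurable_tilt θ ζ) (tilt_pos θ ζ) (unitBdd_expTransform hu) ht,
    ← expTransform_smoothing (measurable_tilt θ ζ) (tilt_pos θ ζ) hu ht, hfix']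

end TIBRW

/-! ### Convergence in distribution of the centred maximum -/

theorem mainTheorem3 (θ : ℝ) (hθ : 0 < θ) (ζ₁ : Measure (Measure ℝ))
    (hζ₁ : TIBRW.IsPointProcessLaw ζ₁) (hA₁ : TIBRW.Assumptions ζ₁)
    (hθ₁ : (θ : EReal) < TIBRW.thetaCrit ζ₁) :
    ∃ D : ProbabilityMeasure ℝ,
      TIBRW.IsMeanOneSolution θ ζ₁ D ∧
      (∀ D' : ProbabilityMeasure ℝ, TIBRW.IsMeanOneSolution θ ζ₁ D' → D' = D) ∧
      (∀ᵐ x ∂(D : Measure ℝ), 0 < x) ∧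
      ∀ (k : ℕ) (ζ : Fin (k + 1) → Measure (Measure ℝ)),
        ζ 0 = ζ₁ →
        (∀ i, TIBRW.IsPointProcessLaw (ζ i)) →
        (∀ i, TIBRW.Assumptions (ζ i)) →
        (θ : EReal) < ⨅ i, TIBRW.thetaCrit (ζ i) →
        ∀ q : Fin (k + 1) → ℕ → ℕ,
          (∀ n, ∑ i, q i n = n) →
          (∀ i, Tendsto (q i) atTop atTop) →
          ∀ (Ω : ℕ → Type*) [∀ n, MeasurableSpace (Ω n)]
            (P : ∀ n, Measure (Ω n)) [∀ n, IsProbabilityMeasure (P n)]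
            (N : ∀ n, List ℕ → Ω n → ℕ) (ξ : ∀ n, List ℕ → ℕ → Ω n → ℝ)
            (E : ∀ n, List ℕ → Ω n → ℝ),
            (∀ n, TIBRW.IsLPMTIBRW ζ (fun i => q i n) (P n) (N n) (ξ n) (E n)) →
            TendstoInDistribution
              (fun n ω =>
                TIBRW.rightmost θ n (fun v => N n v ω) (fun v j => ξ n v j ω) (fun v => E n v ω)
                  - ∑ i, (q i n : ℝ) * TIBRW.nu (ζ i) θ / θ)
              atTop
              (fun w : ℝ × ℝ => 1 / θ * (Real.log w.1 - Real.log w.2))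
              P ((D : Measure ℝ).prod (expMeasure 1)) := by
  obtain ⟨κ₁, hκ₁⟩ := hζ₁
  have hprob₁ := hκ₁.isProbabilityMeasure
  have hsmall : ∀ᶠ δ in 𝓝[>] (0 : ℝ), 0 < δ ∧ δ < 1 := Ioo_mem_nhdsGT one_pos
  obtain ⟨δ₁, ⟨m₁, C₁, hm₁, hm₁', hw₁⟩, hδ₁, hδ₁'⟩ :=
    ((hκ₁.eventually_isWeight hA₁ hθ hθ₁).and hsmall).exists
  obtain ⟨D, hDfix, hD0, hDint, hDmean⟩ := TIBRW.exists_fixedPoint hw₁ hδ₁ hδ₁'.le hm₁ hm₁'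
  have hD : TIBRW.IsMeanOneSolution θ ζ₁ D := ⟨hDint, hDmean, κ₁, hκ₁, hDfix⟩
  have hDpos := TIBRW.ae_pos_of_fixed (TIBRW.measurable_tilt θ ζ₁) (TIBRW.tilt_pos θ ζ₁)
    (hκ₁.ae_one_le hA₁) (hκ₁.not_ae_eq_one hA₁) hDfix hD0 hDmean
  refine ⟨D, hD, fun D' hD' => ?_, hDpos, ?_⟩
  · have had : ∀ ρ : Measure ℝ, ∀ᵐ x ∂ρ, x * Complex.I.re ≤ 0 := fun ρ => by simp
    have heq : (D' : Measure ℝ) = D := TIBRW.expTransform_I_eq_of_fixed hw₁ hδ₁ hm₁ hm₁'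
      hD'.integrable hD'.mean_eq_one hDint hDmean
      (fun t ht => hD'.expTransform_fixed hκ₁ (had _) ht)
      (fun t ht => hD.expTransform_fixed hκ₁ (had _) ht)
    exact Subtype.ext heq
  intro k ζ h0 hζ hA hcrit q hqsum hq Ω _ P _ N ξ E hL
  subst h0
  choose κ hκ using hζ
  -- One exponent for all phases, chosen afresh: `D` was built with `δ₁`, before the later phases
  -- were given.
  obtain ⟨δ, hwδ, hδ, hδ1⟩ := ((eventually_all.2 fun i => (hκ i).eventually_isWeight (hA i) hθ
    (hcrit.trans_le (iInf_le _ i))).and hsmall).exists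
  choose m C hm hm1 hw using hwδ
  have hCnn : ∀ i, 0 ≤ C i := fun i => (hw i).constant_nonneg
  have hterm : ∀ i, 0 ≤ 3 * (C i + 1) / (1 - m i) := fun i =>
    div_nonneg (by linarith [hCnn i]) (by linarith [hm1 i])
  obtain ⟨B, hB, hBm⟩ : ∃ B : ℝ, 0 ≤ B ∧ ∀ i, 3 * (C i + 1) + B * m i ≤ B := by
    -- Each condition says `B ≥ 3 (C i + 1) / (1 - m i)`; the sum dominates every term.
    refine ⟨∑ i, 3 * (C i + 1) / (1 - m i), Finset.sum_nonneg fun i _ => hterm i, fun i => ?_⟩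
    have h1 := Finset.single_le_sum (f := fun i => 3 * (C i + 1) / (1 - m i))
      (fun j _ => hterm j) (Finset.mem_univ i)
    have h2 := (div_le_iff₀ (show 0 < 1 - m i by linarith [hm1 i])).1 h1
    linarith
  choose F hF hFB hFeq using fun n => (hL n).exists_real_rightmost_sub_le_eq hA hκ hθ hδ hδ1.le hB
    hw hBm
  simp only [hqsum] at hFeq
  have hmeas : ∀ n, Measurable fun ω =>
      TIBRW.rightmost θ n (fun v => N n v ω) (fun v j => ξ n v j ω) (fun v => E n v ω)
        - ∑ i, (q i n : ℝ) * TIBRW.nu (ζ i) θ / θ := fun n =>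
    (TIBRW.measurable_rightmost (hL n).measurable_N (hL n).measurable_ξ
      (hL n).measurable_E).sub_const _
  have hmlim : Measurable fun w : ℝ × ℝ => 1 / θ * (Real.log w.1 - Real.log w.2) := by fun_prop
  refine ⟨fun n => (hmeas n).aemeasurable, hmlim.aemeasurable,
    TIBRW.tendsto_of_tendsto_Iic fun x => ?_⟩
  have hu : (-1 : ℂ).re ≤ 0 := by simp
  have hu1 : ‖(-1 : ℂ)‖ = 1 := by simp
  have had := TIBRW.ae_mul_re_nonpos hD0 hu
  have hfixL : ∀ t, 0 ≤ t → TIBRW.branchOp (κ 0) (TIBRW.tilt θ (ζ 0))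
      (TIBRW.expTransform (-1) D) t = TIBRW.expTransform (-1) D t := fun t ht =>
    hD.expTransform_fixed (hκ 0) had ht
  have hexp : 0 ≤ Real.exp (-(θ * x)) := (Real.exp_pos _).le
  -- Both `F n` and the Laplace transform of `D` are close to `e^{-t}`, the former within `B t ^ (1
  -- + δ)` uniformly in `n`, so the growing number of first-phase iterations merges them.
  have hconv := TIBRW.tendsto_iterate_branchOp_sub (hw 0) (hm 0) (hm1 0) hF
    (TIBRW.unitBdd_expTransform had) (fun ε hε => by
      obtain ⟨b, hb, hbound⟩ := TIBRW.expTransform_near_expFun hδ hu hu1 had hDint hDmean hε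
      refine ⟨B + b, by positivity, fun n t ht => ?_⟩
      have h1 := hFB n t ht
      have h2 := hbound t ht
      rw [norm_sub_rev] at h2
      have h3 := norm_sub_le_norm_sub_add_norm_sub (F n t) (TIBRW.expFun (-1) t)
        (TIBRW.expTransform (-1) D t)
      linarith) (hq 0) hexp
  simp only [TIBRW.iterate_branchOp_of_fixed (TIBRW.tilt_pos θ (ζ 0)) hfixL _ hexp, ← hFeq]
    at hconv
  rw [← TIBRW.integral_ite_log_sub_log hθ hDpos, TIBRW.integral_ite_eq_real
    (measurableSet_le hmlim measurable_const)] at hconv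
  have hconv' := tendsto_sub_nhds_zero_iff.1 hconv
  have hre := (Complex.continuous_re.tendsto _).comp hconv'
  simp only [Complex.ofReal_re] at hre
  have hlim : ((D : Measure ℝ).prod (expMeasure 1)).real
      {w | 1 / θ * (Real.log w.1 - Real.log w.2) ≤ x}
      = (((D : Measure ℝ).prod (expMeasure 1)).map
        fun w : ℝ × ℝ => 1 / θ * (Real.log w.1 - Real.log w.2)).real (Set.Iic x) := by
    rw [map_measureReal_apply hmlim measurableSet_Iic]
    rfl
  rw [hlim] at hre
  refine hre.congr fun n => ?_
  simp only [Function.comp_apply, Complex.ofReal_re]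
  exact (map_measureReal_apply (hmeas n) measurableSet_Iic).symm
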